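/- Let $M$ be a smooth 4-manifold with a smooth metric $g$ of signature $(-,+,+,+)$ that is a Yang Pure Space, i.e. its Ricci tensor satisfies $\nabla_aR_{bc}-\nabla_bR_{ac}=0$. Say that the Ricci tensor has Segré type $\{(2,11)\}$ with eigenvalue $\lambda$ at a point if the Jordan form of $R^a{}_b$ there consists of one block of size two and two blocks of size one, all with eigenvalue $\lambda$. A double null eigenvector is a non-zero null vector $k$ with $R^a{}_bk^b=\lambda k^a$ and $R^a{}_bw^b=\lambda w^a+k^a$ for some $\lambda$ and some vector $w$. 1. For every real $\Lambda$ the following are equivalent: (a) Einstein's equations $R_{ab}-\tfrac12Rg_{ab}+\Lambda g_{ab}=8\pi T_{ab}$ hold with a pure radiation energy-momentum tensor $T_{ab}=Hk_ak_b$ ($k$ null and non-zero and $H\neq0$ at every point), or with $T_{ab}=F_{ac}F_b{}^c-\tfrac14g_{ab}F_{cd}F^{cd}$ for a null electromagnetic field $F$ (a 2-form, non-zero at every point, with $F_{ab}F^{ab}=F_{ab}{}^{\star}F^{ab}=0$); (b) at every point the Ricci tensor has Segré type $\{(2,11)\}$ with eigenvalue $\Lambda$. If $M$ is connected and the Ricci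 tensor has Segré type $\{(2,11)\}$ at every point, then its eigenvalue is the same at all points, so that (a) and (b) hold for some $\Lambda$. 2. If the Ricci tensor has Segré type $\{(2,11)\}$ at every point, then $(M,g)$ lies in Kundt's class: it carries a smooth field $L$ of null lines all of whose smooth nowhere vanishing local sections $k$ are tangent to (not necessarily affinely parametrised) geodesics and are free of expansion, twist and shear, i.e. $k_{a;b}m^a\bar m^b=0=k_{a;b}m^am^b$ for every null tetrad $(k,n,m,\bar m)$. Moreover $L$ can be chosen so that at every point the non-zero vectors of $L$ are exactly the double null eigenvectors of the Ricci tensor; they are repeated principal null directions of the Weyl tensor ($C_{abc[d}k_{f]}k^bk^c=0$); and $\Psi_2=C_{abcd}k^am^b\bar m^cn^d$ is real in every null tetrad $(k,n,m,\bar m)$ with $k\in L$. -/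

import Mathlib

open scoped Manifold ContDiff

noncomputable section

/-- The model space of a 4-manifold. -/
abbrev R4 : Type := EuclideanSpace ℝ (Fin 4)

/-! ### Tensor calculus in a coordinate domain

A metric is given here by its component matrix `h y = (g_ij)` as a function of the coordinates `y`.
Conventions: signature `(-,+,+,+)`,
`R^a_bcd = ∂_c Γ^a_db - ∂_d Γ^a_cb + Γ^a_ce Γ^e_db - Γ^a_de Γ^e_cb` and `R_bd = R^a_bad`. -/

namespace Coord

/-- The coordinate derivative `∂_i f`. -/
def pd (i : Fin 4) (f : R4 → ℝ) (y : R4) : ℝ :=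
  fderiv ℝ f y (EuclideanSpace.single i 1)

/-- The Christoffel symbol `Γ^a_bc`. -/
def christoffel (h : R4 → Matrix (Fin 4) (Fin 4) ℝ) (a b c : Fin 4) (y : R4) : ℝ :=
  (1 / 2) * ∑ d, (h y)⁻¹ a d *
    (pd b (fun z => h z d c) y + pd c (fun z => h z d b) y - pd d (fun z => h z b c) y)

/-- The Riemann tensor `R^a_bcd`. -/
def riemannUp (h : R4 → Matrix (Fin 4) (Fin 4) ℝ) (a b c d : Fin 4) (y : R4) : ℝ :=
  pd c (christoffel h a d b) y - pd d (christoffel h a c b) y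
    + ∑ e, (christoffel h a c e y * christoffel h e d b y
        - christoffel h a d e y * christoffel h e c b y)

/-- The Riemann tensor `R_abcd`. -/
def riemann (h : R4 → Matrix (Fin 4) (Fin 4) ℝ) (a b c d : Fin 4) (y : R4) : ℝ :=
  ∑ e, h y a e * riemannUp h e b c d y

/-- The Ricci tensor `R_ab`. -/
def ricci (h : R4 → Matrix (Fin 4) (Fin 4) ℝ) (a b : Fin 4) (y : R4) : ℝ :=
  ∑ c, riemannUp h c a c b y

/-- The Ricci tensor `R^a_b`, as the matrix of an endomorphism. -/
def ricciEnd (h : R4 → Matrix (Fin 4) (Fin 4) ℝ) (y : R4) : Matrix (Fin 4) (Fin 4) ℝ :=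
  fun a b => ∑ c, (h y)⁻¹ a c * ricci h c b y

/-- The Ricci scalar `R`. -/
def scalar (h : R4 → Matrix (Fin 4) (Fin 4) ℝ) (y : R4) : ℝ :=
  ∑ a, ricciEnd h y a a

/-- The Weyl tensor `C_abcd`. -/
def weyl (h : R4 → Matrix (Fin 4) (Fin 4) ℝ) (a b c d : Fin 4) (y : R4) : ℝ :=
  riemann h a b c d y
    - (1 / 2) * (h y a c * ricci h b d y - h y a d * ricci h b c y
        + h y b d * ricci h a c y - h y b c * ricci h a d y)
    + scalar h y / 6 * (h y a c * h y b d - h y a d * h y b c)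

/-- The covariant derivative `∇_a R_bc` of the Ricci tensor. -/
def covRicci (h : R4 → Matrix (Fin 4) (Fin 4) ℝ) (a b c : Fin 4) (y : R4) : ℝ :=
  pd a (ricci h b c) y
    - ∑ d, (christoffel h d a b y * ricci h d c y + christoffel h d a c y * ricci h b d y)

/-- The covariant derivative `∇_b K^a` of a vector field with components `K^a`. -/
def covVec (h : R4 → Matrix (Fin 4) (Fin 4) ℝ) (K : R4 → Fin 4 → ℝ) (b a : Fin 4) (y : R4) : ℝ :=
  pd b (fun z => K z a) y + ∑ c, christoffel h a b c y * K y c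

/-- `k_{a;b} = ∇_b k_a`, where `k_a = g_ac K^c`. -/
def covLow (h : R4 → Matrix (Fin 4) (Fin 4) ℝ) (K : R4 → Fin 4 → ℝ) (a b : Fin 4) (y : R4) : ℝ :=
  ∑ c, h y a c * covVec h K b c y

/-- The complex null vector `m = (s + i t) / √2` of a null tetrad. -/
def mVec (s t : Fin 4 → ℝ) (a : Fin 4) : ℂ :=
  ((s a : ℂ) + Complex.I * (t a : ℂ)) / ((Real.sqrt 2 : ℝ) : ℂ)

/-- The Newman-Penrose Weyl scalar `Ψ₂ = C_abcd k^a m^b m̄^c n^d`. -/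
def psi2 (h : R4 → Matrix (Fin 4) (Fin 4) ℝ) (y : R4) (k n s t : Fin 4 → ℝ) : ℂ :=
  ∑ a, ∑ b, ∑ c, ∑ d, (weyl h a b c d y : ℂ) * (k a : ℂ) * mVec s t b *
    (starRingEnd ℂ) (mVec s t c) * (n d : ℂ)

/-- The Newman-Penrose spin coefficient `ρ = -k_{a;b} m^a m̄^b`. -/
def npRho (h : R4 → Matrix (Fin 4) (Fin 4) ℝ) (K : R4 → Fin 4 → ℝ) (y : R4)
    (s t : Fin 4 → ℝ) : ℂ :=
  -∑ a, ∑ b, (covLow h K a b y : ℂ) * mVec s t a * (starRingEnd ℂ) (mVec s t b)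

/-- The Newman-Penrose spin coefficient `σ = -k_{a;b} m^a m^b`, the complex shear. -/
def npSigma (h : R4 → Matrix (Fin 4) (Fin 4) ℝ) (K : R4 → Fin 4 → ℝ) (y : R4)
    (s t : Fin 4 → ℝ) : ℂ :=
  -∑ a, ∑ b, (covLow h K a b y : ℂ) * mVec s t a * mVec s t b

/-- The expansion `Θ`, where `ρ = -(Θ + i ω)`. -/
def expansion (h : R4 → Matrix (Fin 4) (Fin 4) ℝ) (K : R4 → Fin 4 → ℝ) (y : R4)
    (s t : Fin 4 → ℝ) : ℝ := -(npRho h K y s t).re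

/-- The twist `ω`, where `ρ = -(Θ + i ω)`. -/
def twist (h : R4 → Matrix (Fin 4) (Fin 4) ℝ) (K : R4 → Fin 4 → ℝ) (y : R4)
    (s t : Fin 4 → ℝ) : ℝ := -(npRho h K y s t).im

/-- The energy-momentum tensor `F_ac F_b^c - (1/4) g_ab F_cd F^cd` at a point with metric
components `G`. -/
def emStress (G F : Matrix (Fin 4) (Fin 4) ℝ) (a b : Fin 4) : ℝ :=
  (∑ c, ∑ d, G⁻¹ c d * F a c * F b d)
    - (1 / 4) * G a b * ∑ c, ∑ d, ∑ c', ∑ d', G⁻¹ c c' * G⁻¹ d d' * F c d * F c' d'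

/-- A 2-form is null: it is not zero and both its invariants `F_ab F^ab` and
`F_ab ⋆F^ab` vanish. The second one is a nonzero multiple of
`F_01 F_23 - F_02 F_13 + F_03 F_12`. -/
def IsNullForm (G F : Matrix (Fin 4) (Fin 4) ℝ) : Prop :=
  F ≠ 0 ∧ (∑ a, ∑ b, ∑ a', ∑ b', G⁻¹ a a' * G⁻¹ b b' * F a b * F a' b') = 0 ∧
    F 0 1 * F 2 3 - F 0 2 * F 1 3 + F 0 3 * F 1 2 = 0

end Coord

/-! ### Charts -/

section Charts

variable {M : Type*} [TopologicalSpace M] [ChartedSpace R4 M]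

/-- The tangent space of `M` at `x`. -/
abbrev Tan (x : M) : Type := TangentSpace 𝓘(ℝ, R4) x

/-- `e` is a smooth chart of `M`. -/
abbrev IsChart (e : OpenPartialHomeomorph M R4) : Prop :=
  e ∈ IsManifold.maximalAtlas 𝓘(ℝ, R4) ∞ M

/-- The coordinate vector `∂/∂y^i` of the chart `e` at the point with coordinates `y`. -/
def coordVec (e : OpenPartialHomeomorph M R4) (y : R4) (i : Fin 4) : Tan (e.symm y) :=
  mfderiv 𝓘(ℝ, R4) 𝓘(ℝ, R4) e.symm y (EuclideanSpace.single i (1 : ℝ) : R4)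

/-- The components `v^i` in the chart `e` of a tangent vector `v` at `x`. -/
def vecComp (e : OpenPartialHomeomorph M R4) (x : M) (v : Tan x) : Fin 4 → ℝ :=
  let w : R4 := mfderiv 𝓘(ℝ, R4) 𝓘(ℝ, R4) e x v
  fun i => w i

/-- The components in the chart `e` of a vector field, as functions of the coordinates. -/
def fieldComp (e : OpenPartialHomeomorph M R4) (k : ∀ x : M, Tan x) (y : R4) : Fin 4 → ℝ :=
  vecComp e (e.symm y) (k (e.symm y))

/-- The components `B_ij` in the chart `e` of a field of bilinear forms, as functions of the
coordinates. -/
def formComp (e : OpenPartialHomeomorph M R4) (B : ∀ x : M, LinearMap.BilinForm ℝ (Tan x))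
    (y : R4) : Matrix (Fin 4) (Fin 4) ℝ :=
  fun i j => B (e.symm y) (coordVec e y i) (coordVec e y j)

/-- The vector field `k` is smooth on the open set `U`. -/
def IsSmoothVectorField (U : Set M) (k : ∀ x : M, Tan x) : Prop :=
  ∀ e : OpenPartialHomeomorph M R4, IsChart e → ∀ i,
    ContDiffOn ℝ ∞ (fun y => fieldComp e k y i) (e.target ∩ e.symm ⁻¹' U)

end Charts

/-! ### Lorentz manifolds -/

/-- A smooth Lorentz metric of signature `(-,+,+,+)` on the 4-manifold `M`. -/
structure LorentzMetric (M : Type*) [TopologicalSpace M] [ChartedSpace R4 M] where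
  form : ∀ x : M, LinearMap.BilinForm ℝ (Tan x)
  symm : ∀ (x : M) (u v : Tan x), form x u v = form x v u
  signature : ∀ x : M, ∃ b : Module.Basis (Fin 4) ℝ (Tan x), ∀ i j,
    form x (b i) (b j) = if i = j then (if i = 0 then -1 else 1) else 0
  smooth : ∀ e : OpenPartialHomeomorph M R4, IsChart e → ∀ i j,
    ContDiffOn ℝ ∞ (fun y => formComp e form y i j) e.target

namespace LorentzMetric

variable {M : Type*} [TopologicalSpace M] [ChartedSpace R4 M] (g : LorentzMetric M)

/-- The components `g_ij` of the metric in the chart `e`, as functions of the coordinates. -/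
def comp (e : OpenPartialHomeomorph M R4) : R4 → Matrix (Fin 4) (Fin 4) ℝ :=
  formComp e g.form

/-- Yang's equations `∇_a R_bc - ∇_b R_ac = 0`, in every smooth chart. -/
def IsYangPureSpace : Prop :=
  ∀ e : OpenPartialHomeomorph M R4, IsChart e → ∀ y ∈ e.target, ∀ a b c,
    Coord.covRicci (g.comp e) a b c y - Coord.covRicci (g.comp e) b a c y = 0

/-- The Ricci endomorphism `R^a_b` at `x` maps `v` to `w` (a tensor equation, written in the
components of every smooth chart around `x`). -/
def RicciMapsTo (x : M) (v w : Tan x) : Prop :=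
  ∀ e : OpenPartialHomeomorph M R4, IsChart e → x ∈ e.source →
    (Coord.ricciEnd (g.comp e) (e x)).mulVec (vecComp e x v) = vecComp e x w

/-- The Ricci tensor at `x` has Segré type `{(2,11)}` with eigenvalue `lam`: the Jordan form of
`R^a_b` has one block of size two and two blocks of size one, all with the eigenvalue `lam`. -/
def IsSegre211 (x : M) (lam : ℝ) : Prop :=
  ∃ b : Module.Basis (Fin 4) ℝ (Tan x),
    g.RicciMapsTo x (b 0) (lam • b 0) ∧
    g.RicciMapsTo x (b 1) (lam • b 1 + b 0) ∧
    g.RicciMapsTo x (b 2) (lam • b 2) ∧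
    g.RicciMapsTo x (b 3) (lam • b 3)

/-- `v` is a double null eigenvector of the Ricci tensor at `x`: a nonzero null eigenvector
that belongs to a Jordan block of size two. -/
def IsDoubleNullEigenvector (x : M) (v : Tan x) : Prop :=
  v ≠ 0 ∧ g.form x v v = 0 ∧ ∃ (lam : ℝ) (w : Tan x),
    g.RicciMapsTo x v (lam • v) ∧ g.RicciMapsTo x w (lam • w + v)

/-- The field of symmetric bilinear forms `H k_a k_b`. -/
def radiationStress (H : M → ℝ) (k : ∀ x : M, Tan x) (x : M) : LinearMap.BilinForm ℝ (Tan x) :=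
  H x • (LinearMap.mul ℝ ℝ).compl₁₂ (g.form x (k x)) (g.form x (k x))

/-- Einstein's equations `R_ab - (1/2) R g_ab + Λ g_ab = 8π T_ab` at the point with coordinates
`y` in the chart `e`. -/
def EinsteinEq (Lam : ℝ) (e : OpenPartialHomeomorph M R4) (y : R4)
    (T : Fin 4 → Fin 4 → ℝ) : Prop :=
  ∀ a b, Coord.ricci (g.comp e) a b y - (1 / 2) * Coord.scalar (g.comp e) y * g.comp e y a b
    + Lam * g.comp e y a b = 8 * Real.pi * T a b

/-- Generated, through Einstein's equations with cosmological constant `Lam`, by a pure radiation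
energy-momentum tensor `T_ab = H k_a k_b` (`k` null and nonzero, `H` nowhere zero). -/
def IsPureRadiation (Lam : ℝ) : Prop :=
  ∃ (H : M → ℝ) (k : ∀ x : M, Tan x),
    (∀ x, H x ≠ 0 ∧ k x ≠ 0 ∧ g.form x (k x) (k x) = 0) ∧
    ∀ e : OpenPartialHomeomorph M R4, IsChart e → ∀ y ∈ e.target,
      g.EinsteinEq Lam e y (formComp e (g.radiationStress H k) y)

/-- Generated, through Einstein's equations with cosmological constant `Lam`, by the
energy-momentum tensor of a null electromagnetic field `F`.  Neither smoothness of `F` nor Maxwell's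
equations are demanded, so that no electromagnetic field is excluded. -/
def IsNullElectromagnetic (Lam : ℝ) : Prop :=
  ∃ F : ∀ x : M, LinearMap.BilinForm ℝ (Tan x),
    (∀ x u v, F x u v = -F x v u) ∧
    ∀ e : OpenPartialHomeomorph M R4, IsChart e → ∀ y ∈ e.target,
      Coord.IsNullForm (g.comp e y) (formComp e F y) ∧
      g.EinsteinEq Lam e y (Coord.emStress (g.comp e y) (formComp e F y))

/-- `k, n, m = (s + i t) / √2, m̄` is a null tetrad at `x`: `k·n = -1`, `m·m̄ = 1`, and all
other products vanish. -/
structure IsNullTetrad (x : M) (k n s t : Tan x) : Prop where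
  kk : g.form x k k = 0
  nn : g.form x n n = 0
  kn : g.form x k n = -1
  ss : g.form x s s = 1
  tt : g.form x t t = 1
  st : g.form x s t = 0
  ks : g.form x k s = 0
  kt : g.form x k t = 0
  ns : g.form x n s = 0
  nt : g.form x n t = 0

/-- `v` is a repeated principal null direction of the Weyl tensor at `x` (Bel's criterion):
`v` is null, nonzero and `C_abc[d v_f] v^b v^c = 0`. -/
def IsRepeatedPND (x : M) (v : Tan x) : Prop :=
  v ≠ 0 ∧ g.form x v v = 0 ∧
  ∀ e : OpenPartialHomeomorph M R4, IsChart e → x ∈ e.source → ∀ a d f,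
    ∑ b, ∑ c, vecComp e x v b * vecComp e x v c *
      (Coord.weyl (g.comp e) a b c d (e x) * (g.comp e (e x)).mulVec (vecComp e x v) f
        - Coord.weyl (g.comp e) a b c f (e x) * (g.comp e (e x)).mulVec (vecComp e x v) d) = 0

/-- The Weyl scalar `Ψ₂` of the null tetrad at `x` is real. -/
def Psi2Real (x : M) (k n s t : Tan x) : Prop :=
  ∀ e : OpenPartialHomeomorph M R4, IsChart e → x ∈ e.source →
    Coord.psi2 (g.comp e) (e x) (vecComp e x k) (vecComp e x n) (vecComp e x s) (vecComp e x t)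
      = (starRingEnd ℂ) (Coord.psi2 (g.comp e) (e x)
          (vecComp e x k) (vecComp e x n) (vecComp e x s) (vecComp e x t))

/-- The integral curve of `k` through `x` is a (not necessarily affinely parametrised) geodesic
at `x`: `k^b ∇_b k^a` is a multiple of `k^a`. -/
def IsGeodesicAt (k : ∀ x : M, Tan x) (x : M) : Prop :=
  ∀ e : OpenPartialHomeomorph M R4, IsChart e → x ∈ e.source → ∃ f : ℝ, ∀ a,
    ∑ b, vecComp e x (k x) b * Coord.covVec (g.comp e) (fieldComp e k) b a (e x)
      = f * vecComp e x (k x) a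

/-- The null vector field `k` has no expansion, no twist and no shear at `x`, with respect to
every null tetrad `k, n, m, m̄` at `x`. -/
def IsOpticallyTrivialAt (k : ∀ x : M, Tan x) (x : M) : Prop :=
  ∀ n s t : Tan x, g.IsNullTetrad x (k x) n s t →
  ∀ e : OpenPartialHomeomorph M R4, IsChart e → x ∈ e.source →
    Coord.expansion (g.comp e) (fieldComp e k) (e x) (vecComp e x s) (vecComp e x t) = 0 ∧
    Coord.twist (g.comp e) (fieldComp e k) (e x) (vecComp e x s) (vecComp e x t) = 0 ∧
    Coord.npSigma (g.comp e) (fieldComp e k) (e x) (vecComp e x s) (vecComp e x t) = 0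

/-- `L` is a null congruence as required of a member of Kundt's class: a smooth field of null
lines (spanned near each point by a smooth nowhere vanishing vector field), all of whose smooth
nowhere vanishing local sections are null, geodesic, and free of expansion, twist and shear. -/
def IsKundtCongruence (L : ∀ x : M, Submodule ℝ (Tan x)) : Prop :=
  (∀ x : M, ∃ U : Set M, IsOpen U ∧ x ∈ U ∧ ∃ k : ∀ x : M, Tan x,
    IsSmoothVectorField U k ∧ ∀ z ∈ U, k z ≠ 0 ∧ L z = Submodule.span ℝ {k z}) ∧
  ∀ (U : Set M) (k : ∀ x : M, Tan x), IsOpen U → IsSmoothVectorField U k →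
    (∀ z ∈ U, k z ≠ 0 ∧ k z ∈ L z) →
    ∀ z ∈ U, g.form z (k z) (k z) = 0 ∧ g.IsGeodesicAt k z ∧ g.IsOpticallyTrivialAt k z

/-- The space-time lies in Kundt's class: it admits a null geodesic congruence without
expansion, twist and shear. -/
def InKundtClass : Prop :=
  ∃ L : ∀ x : M, Submodule ℝ (Tan x), g.IsKundtCongruence L

end LorentzMetric

end

/-! The type {(2,11)} with eigenvalue λ is the normal form R_ab = λ g_ab + φ v_a v_b with v null and
non-zero and φ ≠ 0 (`isSegre211_iff`): R^a_b is self-adjoint for g, so the nilpotent part of rank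
one must be φ v ⊗ v♭. Everything is derived from this form.

Part 1. A pure radiation source has trace zero, so Einstein's equations force R = 4Λ and become the
normal form with λ = Λ. The stress of a null electromagnetic field is itself of the form φ κ_a κ_b
with κ null: in an orthonormal frame κ consists of the energy density and the Poynting vector
(`exists_null_stress`). The trace of Yang's equations, compared with the contracted Bianchi
identity, gives dR = 0 (`pd_scalar_eq_zero`); since R = 4λ, the eigenvalue is locally constant.

Part 2, congruence. Write R^c_b = w_b K^c + (R/4) δ^c_b with R constant. Yang's equations become w_b
∇_a K^c - w_a ∇_b K^c + (dw)_ab K^c = 0 (`exists_codazzi_field`). Contraction with a vector X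
orthogonal to K shows that ∇_X K is a multiple of K (`exists_covVec_eq`). The choice X = K gives
geodesics, and k_{a;b} vanishes on the orthogonal complement of K, so ρ = σ = 0.

Part 2, curvature. Differentiating Yang's equations and antisymmetrising leaves a cyclic identity
between the Riemann and Ricci tensors (`curv_ricciEnd_cyclic`). Its λ part is the first Bianchi
identity; the rest says that R_cfea v^f v_b, summed cyclically over e, a, b, vanishes
(`riem_vec_cyclic`). Hence C_abcd v^b v^c is a multiple of v_a v_d, which is Bel's criterion, and
R(n, v, s, t) = 0 for s, t orthogonal to v, which makes Ψ₂ real.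

Calculations are done with connection matrices Γ_c and curvature matrices Ω_cd = ∂_c Γ_d - ∂_d Γ_c +
[Γ_c, Γ_d], so that differential identities reduce to noncommutative algebra. -/

open Filter Topology Matrix

set_option linter.unusedSectionVars false

noncomputable section

namespace Coord

/-! ### Coordinate derivatives of functions and of matrices of functions -/

section Derivatives

variable {U : Set R4} {f f' : R4 → ℝ} {y : R4}

theorem pd_congr (hff : f =ᶠ[𝓝 y] f') (i : Fin 4) : pd i f y = pd i f' y := by
  unfold pd; rw [hff.fderiv_eq]

theorem pd_const (c : ℝ) (i : Fin 4) (y : R4) : pd i (fun _ => c) y = 0 := by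
  simp [pd]

theorem pd_add (hf : DifferentiableAt ℝ f y) (hf' : DifferentiableAt ℝ f' y) (i : Fin 4) :
    pd i (fun z => f z + f' z) y = pd i f y + pd i f' y := by
  simp [pd, fderiv_fun_add hf hf']

theorem pd_sub (hf : DifferentiableAt ℝ f y) (hf' : DifferentiableAt ℝ f' y) (i : Fin 4) :
    pd i (fun z => f z - f' z) y = pd i f y - pd i f' y := by
  simp [pd, fderiv_fun_sub hf hf']

theorem pd_mul (hf : DifferentiableAt ℝ f y) (hf' : DifferentiableAt ℝ f' y) (i : Fin 4) :
    pd i (fun z => f z * f' z) y = pd i f y * f' y + f y * pd i f' y := by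
  simp [pd, fderiv_fun_mul hf hf']; ring

theorem pd_sum {ι : Type*} (s : Finset ι) {F : ι → R4 → ℝ}
    (hF : ∀ j ∈ s, DifferentiableAt ℝ (F j) y) (i : Fin 4) :
    pd i (fun z => ∑ j ∈ s, F j z) y = ∑ j ∈ s, pd i (F j) y := by
  simp [pd, fderiv_fun_sum hF]

theorem contDiffOn_pd (hU : IsOpen U) (hf : ContDiffOn ℝ ∞ f U) (i : Fin 4) :
    ContDiffOn ℝ ∞ (pd i f) U :=
  (hf.fderiv_of_isOpen hU (by simp)).clm_apply contDiffOn_const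

theorem differentiableAt_of_contDiffOn (hU : IsOpen U) (hf : ContDiffOn ℝ ∞ f U) (hy : y ∈ U) :
    DifferentiableAt ℝ f y :=
  (hf.contDiffAt (hU.mem_nhds hy)).differentiableAt (by simp)

theorem pd_comm (hU : IsOpen U) (hf : ContDiffOn ℝ ∞ f U) (hy : y ∈ U) (i j : Fin 4) :
    pd i (pd j f) y = pd j (pd i f) y := by
  have hd : DifferentiableAt ℝ (fderiv ℝ f) y :=
    ((hf.fderiv_of_isOpen hU (m := 1) (by rw [one_add_one_eq_two]; exact ENat.LEInfty.out)).contDiffAt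
      (hU.mem_nhds hy)).differentiableAt (by simp)
  have key : ∀ i j : Fin 4, pd i (pd j f) y =
      fderiv ℝ (fderiv ℝ f) y (EuclideanSpace.single i 1) (EuclideanSpace.single j 1) := by
    intro i j
    unfold pd
    rw [fderiv_clm_apply hd (by fun_prop)]
    simp
  rw [key, key]
  refine ((hf.contDiffAt (hU.mem_nhds hy)).isSymmSndFDerivAt ?_) _ _
  simp only [minSmoothness_of_isRCLikeNormedField]
  exact ENat.LEInfty.out

/-- The entrywise coordinate derivative of a matrix of functions. -/
def pdM (i : Fin 4) (F : R4 → Matrix (Fin 4) (Fin 4) ℝ) (y : R4) : Matrix (Fin 4) (Fin 4) ℝ :=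
  fun a b => pd i (fun z => F z a b) y

/-- All entries of a matrix of functions are smooth on `U`. -/
def SmoothMat (U : Set R4) (F : R4 → Matrix (Fin 4) (Fin 4) ℝ) : Prop :=
  ∀ a b, ContDiffOn ℝ ∞ (fun y => F y a b) U

variable {F F' : R4 → Matrix (Fin 4) (Fin 4) ℝ}

theorem pdM_congr (hFF : F =ᶠ[𝓝 y] F') (i : Fin 4) : pdM i F y = pdM i F' y := by
  ext a b
  exact pd_congr (hFF.mono fun z hz => by simp [hz]) i

theorem pdM_congr_of_eqOn (hU : IsOpen U) (hFF : Set.EqOn F F' U) (hy : y ∈ U) (i : Fin 4) :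
    pdM i F y = pdM i F' y :=
  pdM_congr (hFF.eventuallyEq_of_mem (hU.mem_nhds hy)) i

theorem pdM_const (A : Matrix (Fin 4) (Fin 4) ℝ) (i : Fin 4) (y : R4) :
    pdM i (fun _ => A) y = 0 := by
  ext a b; exact pd_const _ _ _

theorem pdM_transpose (F : R4 → Matrix (Fin 4) (Fin 4) ℝ) (i : Fin 4) (y : R4) :
    pdM i (fun z => (F z)ᵀ) y = (pdM i F y)ᵀ := rfl

namespace SmoothMat

theorem differentiableAt (hF : SmoothMat U F) (hU : IsOpen U) (hy : y ∈ U) (a b : Fin 4) :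
    DifferentiableAt ℝ (fun z => F z a b) y :=
  differentiableAt_of_contDiffOn hU (hF a b) hy

theorem const (A : Matrix (Fin 4) (Fin 4) ℝ) : SmoothMat U (fun _ => A) :=
  fun _ _ => contDiffOn_const

theorem add (hF : SmoothMat U F) (hF' : SmoothMat U F') : SmoothMat U (fun z => F z + F' z) :=
  fun a b => (hF a b).add (hF' a b)

theorem sub (hF : SmoothMat U F) (hF' : SmoothMat U F') : SmoothMat U (fun z => F z - F' z) :=
  fun a b => (hF a b).sub (hF' a b)

theorem transpose (hF : SmoothMat U F) : SmoothMat U (fun z => (F z)ᵀ) :=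
  fun a b => hF b a

theorem mul (hF : SmoothMat U F) (hF' : SmoothMat U F') : SmoothMat U (fun z => F z * F' z) := by
  intro a b
  simp only [Matrix.mul_apply]
  exact ContDiffOn.sum fun c _ => (hF a c).mul (hF' c b)

theorem det (hF : SmoothMat U F) : ContDiffOn ℝ ∞ (fun z => (F z).det) U := by
  simp only [Matrix.det_apply]
  refine ContDiffOn.sum fun σ _ => ContDiffOn.const_smul _ ?_
  exact contDiffOn_prod fun c _ => hF _ _

theorem inv (hF : SmoothMat U F) (hdet : ∀ z ∈ U, (F z).det ≠ 0) :
    SmoothMat U (fun z => (F z)⁻¹) := by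
  intro a b
  simp only [Matrix.inv_def, Ring.inverse_eq_inv', Matrix.smul_apply, smul_eq_mul,
    Matrix.adjugate_apply]
  refine (hF.det.inv hdet).mul (SmoothMat.det fun c d => ?_)
  simp only [Matrix.updateRow_apply]
  split_ifs
  · exact contDiffOn_const
  · exact hF _ _

theorem pdM (hF : SmoothMat U F) (hU : IsOpen U) (i : Fin 4) : SmoothMat U (pdM i F) :=
  fun a b => contDiffOn_pd hU (hF a b) i

end SmoothMat

theorem pdM_add (hU : IsOpen U) (hF : SmoothMat U F) (hF' : SmoothMat U F') (hy : y ∈ U)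
    (i : Fin 4) : pdM i (fun z => F z + F' z) y = pdM i F y + pdM i F' y := by
  ext a b
  exact pd_add (hF.differentiableAt hU hy a b) (hF'.differentiableAt hU hy a b) i

theorem pdM_sub (hU : IsOpen U) (hF : SmoothMat U F) (hF' : SmoothMat U F') (hy : y ∈ U)
    (i : Fin 4) : pdM i (fun z => F z - F' z) y = pdM i F y - pdM i F' y := by
  ext a b
  exact pd_sub (hF.differentiableAt hU hy a b) (hF'.differentiableAt hU hy a b) i

theorem pdM_mul (hU : IsOpen U) (hF : SmoothMat U F) (hF' : SmoothMat U F') (hy : y ∈ U)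
    (i : Fin 4) : pdM i (fun z => F z * F' z) y = pdM i F y * F' y + F y * pdM i F' y := by
  ext a b
  simp only [pdM, Matrix.mul_apply, Matrix.add_apply]
  rw [pd_sum Finset.univ (F := fun c z => F z a c * F' z c b) (fun c _ =>
    (hF.differentiableAt hU hy a c).mul (hF'.differentiableAt hU hy c b)), ← Finset.sum_add_distrib]
  exact Finset.sum_congr rfl fun c _ =>
    pd_mul (hF.differentiableAt hU hy a c) (hF'.differentiableAt hU hy c b) i

theorem pdM_comm (hU : IsOpen U) (hF : SmoothMat U F) (hy : y ∈ U) (i j : Fin 4) :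
    pdM i (pdM j F) y = pdM j (pdM i F) y := by
  ext a b
  exact pd_comm hU (hF a b) hy i j

end Derivatives

/-! ### Connection and curvature matrices -/

/-- `h` is a smooth pseudo-Riemannian metric on the open set `U`, in components. -/
structure IsMetricOn (U : Set R4) (h : R4 → Matrix (Fin 4) (Fin 4) ℝ) : Prop where
  isOpen : IsOpen U
  smooth : SmoothMat U h
  symm : ∀ y ∈ U, (h y)ᵀ = h y
  det_ne : ∀ y ∈ U, (h y).det ≠ 0

/-- The connection matrix `(Γ_c)^a_b = Γ^a_cb`. -/
def conn (h : R4 → Matrix (Fin 4) (Fin 4) ℝ) (c : Fin 4) (y : R4) : Matrix (Fin 4) (Fin 4) ℝ :=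
  fun a b => christoffel h a c b y

/-- The curvature matrix `(Ω_cd)^a_b = R^a_bcd`. -/
def curv (h : R4 → Matrix (Fin 4) (Fin 4) ℝ) (c d : Fin 4) (y : R4) : Matrix (Fin 4) (Fin 4) ℝ :=
  fun a b => riemannUp h a b c d y

/-- The curvature with raised index, `P^{ab}_cd`. -/
def curvUp (h : R4 → Matrix (Fin 4) (Fin 4) ℝ) (c d : Fin 4) (y : R4) :
    Matrix (Fin 4) (Fin 4) ℝ :=
  curv h c d y * (h y)⁻¹

theorem curv_eq (h : R4 → Matrix (Fin 4) (Fin 4) ℝ) (c d : Fin 4) (y : R4) :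
    curv h c d y = pdM c (conn h d) y - pdM d (conn h c) y
      + (conn h c y * conn h d y - conn h d y * conn h c y) := by
  ext a b
  simp [curv, riemannUp, pdM, conn, Matrix.mul_apply, Finset.sum_sub_distrib]

theorem curv_swap (h : R4 → Matrix (Fin 4) (Fin 4) ℝ) (c d : Fin 4) (y : R4) :
    curv h d c y = -curv h c d y := by
  rw [curv_eq, curv_eq]; abel

namespace IsMetricOn

variable {U : Set R4} {h : R4 → Matrix (Fin 4) (Fin 4) ℝ} {y : R4}

theorem isUnit_det (H : IsMetricOn U h) (hy : y ∈ U) : IsUnit (h y).det :=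
  isUnit_iff_ne_zero.2 (H.det_ne y hy)

theorem apply_symm (H : IsMetricOn U h) (hy : y ∈ U) (a b : Fin 4) : h y a b = h y b a := by
  conv_lhs => rw [← H.symm y hy]
  rfl

theorem inv_symm (H : IsMetricOn U h) (hy : y ∈ U) : ((h y)⁻¹)ᵀ = (h y)⁻¹ := by
  rw [Matrix.transpose_nonsing_inv, H.symm y hy]

theorem inv_apply_symm (H : IsMetricOn U h) (hy : y ∈ U) (a b : Fin 4) :
    (h y)⁻¹ a b = (h y)⁻¹ b a := by
  conv_lhs => rw [← H.inv_symm hy]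
  rfl

theorem smooth_inv (H : IsMetricOn U h) : SmoothMat U (fun z => (h z)⁻¹) :=
  H.smooth.inv H.det_ne

theorem smooth_conn (H : IsMetricOn U h) (c : Fin 4) : SmoothMat U (conn h c) := by
  intro a b
  refine contDiffOn_const.mul (ContDiffOn.sum fun d _ => (H.smooth_inv a d).mul ?_)
  exact ((contDiffOn_pd H.isOpen (H.smooth d b) c).add (contDiffOn_pd H.isOpen (H.smooth d c) b)).sub
    (contDiffOn_pd H.isOpen (H.smooth c b) d)

theorem smooth_curv (H : IsMetricOn U h) (c d : Fin 4) : SmoothMat U (curv h c d) := by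
  have := ((((H.smooth_conn d).pdM H.isOpen c).sub ((H.smooth_conn c).pdM H.isOpen d)).add
    (((H.smooth_conn c).mul (H.smooth_conn d)).sub ((H.smooth_conn d).mul (H.smooth_conn c))))
  intro a b
  exact (this a b).congr fun _ _ => by rw [curv_eq]

theorem pd_symm (H : IsMetricOn U h) (hy : y ∈ U) (c a b : Fin 4) :
    pd c (fun z => h z a b) y = pd c (fun z => h z b a) y :=
  pd_congr (Filter.eventually_of_mem (H.isOpen.mem_nhds hy) fun _ hz => H.apply_symm hz a b) c

theorem christoffel_symm (H : IsMetricOn U h) (hy : y ∈ U) (a b c : Fin 4) :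
    christoffel h a b c y = christoffel h a c b y := by
  unfold christoffel
  congr 1
  refine Finset.sum_congr rfl fun d _ => ?_
  rw [H.pd_symm hy d b c]; ring

/-- Christoffel symbols of the first kind: lowering the index cancels the inverse metric. -/
theorem mul_conn_apply (H : IsMetricOn U h) (hy : y ∈ U) (a b c : Fin 4) :
    (h y * conn h a y) b c = (1 / 2) * (pd a (fun z => h z b c) y + pd c (fun z => h z b a) y
      - pd b (fun z => h z a c) y) := by
  have h1 : conn h a y = (1 / 2 : ℝ) • ((h y)⁻¹ * (Matrix.of fun d c =>
      pd a (fun z => h z d c) y + pd c (fun z => h z d a) y - pd d (fun z => h z a c) y)) := by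
    ext p q; simp [conn, christoffel, Matrix.mul_apply]
  rw [h1, Matrix.mul_smul, Matrix.mul_nonsing_inv_cancel_left _ _ (H.isUnit_det hy)]
  simp

theorem pdM_metric (H : IsMetricOn U h) (hy : y ∈ U) (a : Fin 4) :
    pdM a h y = h y * conn h a y + (h y * conn h a y)ᵀ := by
  ext b c
  rw [Matrix.add_apply, Matrix.transpose_apply, H.mul_conn_apply hy, H.mul_conn_apply hy,
    H.pd_symm hy a c b, H.pd_symm hy b c a, H.pd_symm hy c a b]
  simp only [pdM]; ring

/-- Metricity ∇g = 0, in the form that can be differentiated again. -/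
theorem pdM_metric' (H : IsMetricOn U h) (hy : y ∈ U) (a : Fin 4) :
    pdM a h y = h y * conn h a y + (conn h a y)ᵀ * h y := by
  rw [H.pdM_metric hy, Matrix.transpose_mul, H.symm y hy]

theorem pdM_inv (H : IsMetricOn U h) (hy : y ∈ U) (a : Fin 4) :
    pdM a (fun z => (h z)⁻¹) y = -(conn h a y * (h y)⁻¹) - (h y)⁻¹ * (conn h a y)ᵀ := by
  have h1 : pdM a (fun z => h z * (h z)⁻¹) y = 0 := by
    rw [pdM_congr_of_eqOn H.isOpen (F' := fun _ => 1)
      (fun z hz => Matrix.mul_nonsing_inv _ (H.isUnit_det hz)) hy, pdM_const]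
  rw [pdM_mul H.isOpen H.smooth H.smooth_inv hy, H.pdM_metric' hy] at h1
  have h2 := congrArg ((h y)⁻¹ * ·) h1
  simp only [Matrix.mul_add, Matrix.add_mul, Matrix.mul_zero, Matrix.mul_assoc] at h2
  rw [Matrix.nonsing_inv_mul_cancel_left _ _ (H.isUnit_det hy),
    Matrix.nonsing_inv_mul_cancel_left _ _ (H.isUnit_det hy),
    Matrix.mul_nonsing_inv _ (H.isUnit_det hy), Matrix.mul_one] at h2
  rw [← sub_eq_zero, ← h2]; abel

/-- The lowered curvature matrix `R_abcd` is antisymmetric in `ab`. -/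
theorem mul_curv_transpose (H : IsMetricOn U h) (hy : y ∈ U) (c d : Fin 4) :
    (h y * curv h c d y)ᵀ = -(h y * curv h c d y) := by
  -- Differentiate ∇g = 0 once more. Commuting the two partial derivatives of h then leaves h Ω_cd +
  -- Ω_cdᵀ h = 0.
  have key : ∀ c d, pdM c (pdM d h) y =
      (h y * conn h c y + (conn h c y)ᵀ * h y) * conn h d y + h y * pdM c (conn h d) y
      + ((pdM c (conn h d) y)ᵀ * h y
        + (conn h d y)ᵀ * (h y * conn h c y + (conn h c y)ᵀ * h y)) := by
    intro c d
    rw [pdM_congr_of_eqOn H.isOpen (fun z hz => H.pdM_metric' hz d) hy,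
      pdM_add H.isOpen (H.smooth.mul (H.smooth_conn d)) ((H.smooth_conn d).transpose.mul H.smooth)
        hy, pdM_mul H.isOpen H.smooth (H.smooth_conn d) hy,
      pdM_mul H.isOpen (H.smooth_conn d).transpose H.smooth hy, pdM_transpose, H.pdM_metric' hy]
  have h1 := pdM_comm H.isOpen H.smooth hy c d
  rw [key, key, ← sub_eq_zero] at h1
  rw [Matrix.transpose_mul, H.symm y hy, ← add_eq_zero_iff_eq_neg, ← h1, curv_eq]
  simp only [Matrix.transpose_add, Matrix.transpose_sub, Matrix.transpose_mul]
  noncomm_ring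

theorem riemann_eq (h : R4 → Matrix (Fin 4) (Fin 4) ℝ) (a b c d : Fin 4) (y : R4) :
    riemann h a b c d y = (h y * curv h c d y) a b := by
  simp [riemann, Matrix.mul_apply, curv]

theorem riemann_antisymm_left (H : IsMetricOn U h) (hy : y ∈ U) (a b c d : Fin 4) :
    riemann h b a c d y = -riemann h a b c d y := by
  have := congrFun (congrFun (H.mul_curv_transpose hy c d) a) b
  simpa [riemann_eq] using this

theorem riemann_antisymm_right (h : R4 → Matrix (Fin 4) (Fin 4) ℝ) (a b c d : Fin 4) (y : R4) :
    riemann h a b d c y = -riemann h a b c d y := by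
  rw [riemann_eq, riemann_eq, curv_swap h c d]; simp

/-- First Bianchi identity: since the connection has no torsion, all terms cancel in pairs. -/
theorem riemannUp_cyclic (H : IsMetricOn U h) (hy : y ∈ U) (a b c d : Fin 4) :
    riemannUp h a b c d y + riemannUp h a c d b y + riemannUp h a d b c y = 0 := by
  have hp : ∀ i a b c, pd i (christoffel h a b c) y = pd i (christoffel h a c b) y :=
    fun i a b c => pd_congr (Filter.eventually_of_mem (H.isOpen.mem_nhds hy)
      fun z hz => H.christoffel_symm hz a b c) i
  simp only [riemannUp, Finset.sum_sub_distrib]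
  rw [hp c a d b, hp d a b c, hp b a c d]
  simp only [H.christoffel_symm hy _ d b, H.christoffel_symm hy _ c b, H.christoffel_symm hy _ d c]
  ring

theorem riemann_cyclic (H : IsMetricOn U h) (hy : y ∈ U) (a b c d : Fin 4) :
    riemann h a b c d y + riemann h a c d b y + riemann h a d b c y = 0 := by
  simp only [riemann, ← Finset.sum_add_distrib, ← mul_add, H.riemannUp_cyclic hy]
  simp

/-- The classical argument: four cyclic identities, combined by means of the two antisymmetries. -/
theorem riemann_pair_symm (H : IsMetricOn U h) (hy : y ∈ U) (a b c d : Fin 4) :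
    riemann h c d a b y = riemann h a b c d y := by
  have l := fun a b c d => H.riemann_antisymm_left hy a b c d
  have r := fun a b c d => riemann_antisymm_right h a b c d y
  have z := fun a b c d => H.riemann_cyclic hy a b c d
  linarith [z a b c d, z b c d a, z c d a b, z d a b c, l a b c d, l b c d a, l c d a b, l d a b c,
    r a b c d, r b c d a, r c d a b, r d a b c, l a c d b, l b d a c, r a c d b, r b d a c,
    l a d b c, r a d b c, l b c a d, r c a b d, l c a b d, r b d a c, l c b d a, l d b a c,
    r d b c a, r c a d b, r d a c b, l d c a b, r a c b d, r b d c a, l d b c a, l c a d b,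
    r d b a c, r d c b a, r c d b a, l c d b a, r a b d c, l a b d c]

end IsMetricOn

end Coord

namespace Coord

/-- The covariant derivative `∇_e P^{ab}_cd`, up to the terms that cancel in cyclic sums. -/
def covCurvUp (h : R4 → Matrix (Fin 4) (Fin 4) ℝ) (e c d : Fin 4) (y : R4) :
    Matrix (Fin 4) (Fin 4) ℝ :=
  pdM e (curvUp h c d) y + conn h e y * curvUp h c d y + curvUp h c d y * (conn h e y)ᵀ

/-- Yang's equations in the components of a metric. -/
def IsCodazzi (U : Set R4) (h : R4 → Matrix (Fin 4) (Fin 4) ℝ) : Prop :=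
  ∀ y ∈ U, ∀ a b c, covRicci h a b c y - covRicci h b a c y = 0

namespace IsMetricOn

variable {U : Set R4} {h : R4 → Matrix (Fin 4) (Fin 4) ℝ} {y : R4}

/-! ### The second Bianchi identity -/

theorem pdM_curv (H : IsMetricOn U h) (hy : y ∈ U) (e c d : Fin 4) :
    pdM e (curv h c d) y = pdM e (pdM c (conn h d)) y - pdM e (pdM d (conn h c)) y
      + ((pdM e (conn h c) y * conn h d y + conn h c y * pdM e (conn h d) y)
        - (pdM e (conn h d) y * conn h c y + conn h d y * pdM e (conn h c) y)) := by
  have hc := H.smooth_conn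
  have hO := H.isOpen
  rw [show curv h c d = fun z => (pdM c (conn h d) z - pdM d (conn h c) z)
      + (conn h c z * conn h d z - conn h d z * conn h c z) from funext fun z => curv_eq h c d z,
    pdM_add hO (((hc d).pdM hO c).sub ((hc c).pdM hO d)) (((hc c).mul (hc d)).sub
      ((hc d).mul (hc c))) hy,
    pdM_sub hO ((hc d).pdM hO c) ((hc c).pdM hO d) hy,
    pdM_sub hO ((hc c).mul (hc d)) ((hc d).mul (hc c)) hy,
    pdM_mul hO (hc c) (hc d) hy, pdM_mul hO (hc d) (hc c) hy]

/-- The second Bianchi identity, in matrix form. -/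
theorem bianchi (H : IsMetricOn U h) (hy : y ∈ U) (e c d : Fin 4) :
    (pdM e (curv h c d) y + conn h e y * curv h c d y - curv h c d y * conn h e y)
    + (pdM c (curv h d e) y + conn h c y * curv h d e y - curv h d e y * conn h c y)
    + (pdM d (curv h e c) y + conn h d y * curv h e c y - curv h e c y * conn h d y) = 0 := by
  simp only [H.pdM_curv hy, curv_eq]
  -- Second derivatives of Γ cancel by symmetry; what is left is the Jacobi identity for
  -- commutators.
  rw [pdM_comm H.isOpen (H.smooth_conn d) hy c e, pdM_comm H.isOpen (H.smooth_conn e) hy d c,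
    pdM_comm H.isOpen (H.smooth_conn c) hy e d]
  noncomm_ring

theorem smooth_curvUp (H : IsMetricOn U h) (c d : Fin 4) : SmoothMat U (curvUp h c d) :=
  (H.smooth_curv c d).mul H.smooth_inv

/-- Raising an index commutes with ∇ because the inverse metric is parallel, so the Bianchi identity
passes to P^{ab}_cd. -/
theorem pdM_curvUp (H : IsMetricOn U h) (hy : y ∈ U) (e c d : Fin 4) :
    pdM e (curvUp h c d) y + conn h e y * curvUp h c d y + curvUp h c d y * (conn h e y)ᵀ =
      (pdM e (curv h c d) y + conn h e y * curv h c d y - curv h c d y * conn h e y) * (h y)⁻¹ := by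
  have : pdM e (curvUp h c d) y = _ := pdM_mul H.isOpen (H.smooth_curv c d) H.smooth_inv hy e
  rw [this, H.pdM_inv hy, curvUp]
  noncomm_ring

theorem bianchi_up (H : IsMetricOn U h) (hy : y ∈ U) (e c d : Fin 4) :
    (pdM e (curvUp h c d) y + conn h e y * curvUp h c d y + curvUp h c d y * (conn h e y)ᵀ)
    + (pdM c (curvUp h d e) y + conn h c y * curvUp h d e y + curvUp h d e y * (conn h c y)ᵀ)
    + (pdM d (curvUp h e c) y + conn h d y * curvUp h e c y + curvUp h e c y * (conn h d y)ᵀ)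
      = 0 := by
  simp only [H.pdM_curvUp hy]
  rw [← Matrix.add_mul, ← Matrix.add_mul, H.bianchi hy, Matrix.zero_mul]

theorem curvUp_swap (h : R4 → Matrix (Fin 4) (Fin 4) ℝ) (c d : Fin 4) (y : R4) :
    curvUp h d c y = -curvUp h c d y := by
  rw [curvUp, curv_swap h c d, Matrix.neg_mul, curvUp]

theorem curvUp_transpose (H : IsMetricOn U h) (hy : y ∈ U) (c d : Fin 4) :
    (curvUp h c d y)ᵀ = -curvUp h c d y := by
  have h1 : curvUp h c d y = (h y)⁻¹ * (h y * curv h c d y) * (h y)⁻¹ := by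
    rw [Matrix.nonsing_inv_mul_cancel_left _ _ (H.isUnit_det hy), curvUp]
  rw [h1, Matrix.transpose_mul, Matrix.transpose_mul, H.inv_symm hy, H.mul_curv_transpose hy]
  noncomm_ring

theorem curvUp_antisymm (H : IsMetricOn U h) (hy : y ∈ U) (c d a b : Fin 4) :
    curvUp h c d y a b = -curvUp h c d y b a := by
  rw [← Matrix.neg_apply, ← H.curvUp_transpose hy, Matrix.transpose_apply]

/-! ### The Ricci tensor -/

theorem ricci_symm (H : IsMetricOn U h) (hy : y ∈ U) (a b : Fin 4) :
    ricci h a b y = ricci h b a y := by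
  have key : ∀ a b, ricci h a b y = ∑ c, ∑ f, (h y)⁻¹ c f * riemann h f a c b y := by
    intro a b
    unfold ricci
    refine Finset.sum_congr rfl fun c _ => ?_
    have : curv h c b y = (h y)⁻¹ * (h y * curv h c b y) := by
      rw [Matrix.nonsing_inv_mul_cancel_left _ _ (H.isUnit_det hy)]
    have h2 := congrFun (congrFun this c) a
    rw [Matrix.mul_apply] at h2
    simpa [riemann_eq, curv] using h2
  rw [key, key, Finset.sum_comm]
  refine Finset.sum_congr rfl fun c _ => Finset.sum_congr rfl fun f _ => ?_
  rw [H.inv_apply_symm hy f c, H.riemann_pair_symm hy]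

theorem ricciEnd_eq_mul (h : R4 → Matrix (Fin 4) (Fin 4) ℝ) (y : R4) :
    ricciEnd h y = (h y)⁻¹ * Matrix.of fun a b => ricci h a b y := by
  ext a b
  simp [ricciEnd, Matrix.mul_apply]

theorem mul_ricciEnd_apply (H : IsMetricOn U h) (hy : y ∈ U) (a b : Fin 4) :
    (h y * ricciEnd h y) a b = ricci h a b y := by
  rw [ricciEnd_eq_mul, Matrix.mul_nonsing_inv_cancel_left _ _ (H.isUnit_det hy)]
  rfl

/-- With two indices raised, R^a_b is a plain trace and no metric has to be differentiated when the
Bianchi identity is contracted. -/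
theorem ricciEnd_eq_sum (H : IsMetricOn U h) (hy : y ∈ U) (a b : Fin 4) :
    ricciEnd h y a b = ∑ f, curvUp h f b y f a := by
  simp only [ricciEnd, ricci, curvUp, Matrix.mul_apply, Finset.mul_sum, curv]
  rw [Finset.sum_comm]
  refine Finset.sum_congr rfl fun f _ => Finset.sum_congr rfl fun c _ => ?_
  rw [H.inv_apply_symm hy a c, mul_comm]

theorem smooth_ricci (H : IsMetricOn U h) (a b : Fin 4) : ContDiffOn ℝ ∞ (ricci h a b) U :=
  ContDiffOn.sum fun c _ => H.smooth_curv c b c a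

theorem smooth_ricciEnd (H : IsMetricOn U h) : SmoothMat U (ricciEnd h) :=
  fun a b => ContDiffOn.sum fun c _ => (H.smooth_inv a c).mul (H.smooth_ricci c b)

theorem smooth_scalar (H : IsMetricOn U h) : ContDiffOn ℝ ∞ (scalar h) U :=
  ContDiffOn.sum fun a _ => H.smooth_ricciEnd a a

theorem pd_scalar (H : IsMetricOn U h) (hy : y ∈ U) (e : Fin 4) :
    pd e (scalar h) y = ∑ a, pd e (fun z => ricciEnd h z a a) y :=
  pd_sum Finset.univ (F := fun a z => ricciEnd h z a a)
    (fun a _ => H.smooth_ricciEnd.differentiableAt H.isOpen hy a a) e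

theorem pd_ricciEnd (H : IsMetricOn U h) (hy : y ∈ U) (e a b : Fin 4) :
    pd e (fun z => ricciEnd h z a b) y = ∑ f, pd e (fun z => curvUp h f b z f a) y := by
  rw [← pd_sum Finset.univ (F := fun f z => curvUp h f b z f a)
    (fun f _ => (H.smooth_curvUp f b).differentiableAt H.isOpen hy f a) e]
  exact pd_congr (Filter.eventually_of_mem (H.isOpen.mem_nhds hy)
    fun z hz => H.ricciEnd_eq_sum hz a b) e

theorem curvUp_swap_swap (H : IsMetricOn U h) (hy : y ∈ U) (c d a b : Fin 4) :
    curvUp h c d y a b = curvUp h d c y b a := by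
  rw [H.curvUp_antisymm hy, curvUp_swap h c d, Matrix.neg_apply]

theorem covCurvUp_apply (h : R4 → Matrix (Fin 4) (Fin 4) ℝ) (e c d a b : Fin 4) (y : R4) :
    covCurvUp h e c d y a b = pd e (fun z => curvUp h c d z a b) y
      + ∑ f, conn h e y a f * curvUp h c d y f b + ∑ f, conn h e y b f * curvUp h c d y a f := by
  simp only [covCurvUp, Matrix.add_apply, Matrix.mul_apply, Matrix.transpose_apply, pdM]
  congr 1
  exact Finset.sum_congr rfl fun f _ => mul_comm _ _

theorem covCurvUp_swap_swap (H : IsMetricOn U h) (hy : y ∈ U) (e c d a b : Fin 4) :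
    covCurvUp h e c d y a b = covCurvUp h e d c y b a := by
  rw [covCurvUp_apply, covCurvUp_apply, pd_congr (Filter.eventually_of_mem (H.isOpen.mem_nhds hy)
    fun z hz => H.curvUp_swap_swap hz c d a b) e]
  simp only [H.curvUp_swap_swap hy c d]
  ring

/-- The connection terms survive the double trace because `covCurvUp` omits those belonging to the
lower indices. -/
theorem sum_covCurvUp (H : IsMetricOn U h) (hy : y ∈ U) (e : Fin 4) :
    ∑ a, ∑ b, covCurvUp h e a b y a b =
      pd e (scalar h) y + 2 * ∑ a, ∑ f, conn h e y a f * ricciEnd h y f a := by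
  have h1 : ∑ a, ∑ b, pd e (fun z => curvUp h a b z a b) y = pd e (scalar h) y := by
    simp only [H.pd_scalar hy, H.pd_ricciEnd hy]
    exact Finset.sum_comm
  have h2 : ∑ a, ∑ b, ∑ f, conn h e y a f * curvUp h a b y f b =
      ∑ a, ∑ f, conn h e y a f * ricciEnd h y f a := by
    refine Finset.sum_congr rfl fun a _ => ?_
    rw [Finset.sum_comm]
    refine Finset.sum_congr rfl fun f _ => ?_
    rw [H.ricciEnd_eq_sum hy, Finset.mul_sum]
    exact Finset.sum_congr rfl fun b _ => by rw [H.curvUp_swap_swap hy]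
  have h3 : ∑ a, ∑ b, ∑ f, conn h e y b f * curvUp h a b y a f =
      ∑ a, ∑ f, conn h e y a f * ricciEnd h y f a := by
    rw [Finset.sum_comm]
    refine Finset.sum_congr rfl fun b _ => ?_
    rw [Finset.sum_comm]
    refine Finset.sum_congr rfl fun f _ => ?_
    rw [H.ricciEnd_eq_sum hy, Finset.mul_sum]
  simp only [covCurvUp_apply, Finset.sum_add_distrib, h1, h2, h3]
  ring

theorem sum_covCurvUp' (H : IsMetricOn U h) (hy : y ∈ U) (e : Fin 4) :
    ∑ a, ∑ b, covCurvUp h a b e y a b =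
      -(∑ a, pd a (fun z => ricciEnd h z a e) y
        + ∑ a, ∑ f, conn h a y a f * ricciEnd h y f e) := by
  have h1 : ∑ a, ∑ b, pd a (fun z => curvUp h b e z a b) y =
      -∑ a, pd a (fun z => ricciEnd h z a e) y := by
    simp only [H.pd_ricciEnd hy, ← Finset.sum_neg_distrib]
    refine Finset.sum_congr rfl fun a _ => Finset.sum_congr rfl fun b _ => ?_
    rw [pd_congr (f' := fun z => 0 - curvUp h b e z b a) (Filter.eventually_of_mem
      (H.isOpen.mem_nhds hy) fun z hz => (H.curvUp_antisymm hz b e a b).trans (zero_sub _).symm),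
      pd_sub (by fun_prop) ((H.smooth_curvUp b e).differentiableAt H.isOpen hy b a), pd_const,
      zero_sub]
  have h2 : ∑ a, ∑ b, ∑ f, conn h a y a f * curvUp h b e y f b =
      -∑ a, ∑ f, conn h a y a f * ricciEnd h y f e := by
    simp only [H.ricciEnd_eq_sum hy, Finset.mul_sum, ← Finset.sum_neg_distrib]
    refine Finset.sum_congr rfl fun a _ => ?_
    rw [Finset.sum_comm]
    refine Finset.sum_congr rfl fun f _ => Finset.sum_congr rfl fun b _ => ?_
    rw [H.curvUp_antisymm hy, mul_neg]
  -- Γ^b_af is symmetric and P^{af}_be antisymmetric in a, f.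
  have h3 : ∑ a, ∑ b, ∑ f, conn h a y b f * curvUp h b e y a f = 0 := by
    rw [Finset.sum_comm]
    refine Finset.sum_eq_zero fun b _ => ?_
    have : ∑ a, ∑ f, conn h a y b f * curvUp h b e y a f =
        -∑ a, ∑ f, conn h a y b f * curvUp h b e y a f := by
      conv_lhs => rw [Finset.sum_comm]
      simp only [← Finset.sum_neg_distrib]
      refine Finset.sum_congr rfl fun a _ => Finset.sum_congr rfl fun f _ => ?_
      rw [H.curvUp_antisymm hy b e f a, conn, conn, H.christoffel_symm hy]
      ring
    linarith
  simp only [covCurvUp_apply, Finset.sum_add_distrib, h1, h2, h3]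
  ring

/-- The twice contracted Bianchi identity `∂_e R = 2 ∇_a R^a_e`. -/
theorem bianchi_contracted (H : IsMetricOn U h) (hy : y ∈ U) (e : Fin 4) :
    pd e (scalar h) y + 2 * ∑ a, ∑ f, conn h e y a f * ricciEnd h y f a =
      2 * (∑ a, pd a (fun z => ricciEnd h z a e) y
        + ∑ a, ∑ f, conn h a y a f * ricciEnd h y f e) := by
  have h1 : ∑ a, ∑ b, (covCurvUp h e a b y + covCurvUp h a b e y + covCurvUp h b e a y) a b = 0 :=
    Finset.sum_eq_zero fun a _ => Finset.sum_eq_zero fun b _ => by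
      have := congrFun (congrFun (H.bianchi_up hy e a b) a) b
      exact this
  -- Exchanging both index pairs identifies two of the three cyclic terms, whence the factor 2.
  have h2 : ∑ a, ∑ b, covCurvUp h b e a y a b = ∑ a, ∑ b, covCurvUp h a b e y a b := by
    rw [Finset.sum_comm]
    exact Finset.sum_congr rfl fun a _ => Finset.sum_congr rfl fun b _ =>
      H.covCurvUp_swap_swap hy _ _ _ _ _
  simp only [Matrix.add_apply, Finset.sum_add_distrib, h2, H.sum_covCurvUp hy,
    H.sum_covCurvUp' hy] at h1
  linarith

/-! ### Metrics with a Codazzi Ricci tensor -/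

/-- Yang's equations for the Ricci endomorphism. -/
theorem codazzi_ricciEnd (H : IsMetricOn U h) (hC : IsCodazzi U h) (hy : y ∈ U) (a b c : Fin 4) :
    (pdM a (ricciEnd h) y + conn h a y * ricciEnd h y) c b =
      (pdM b (ricciEnd h) y + conn h b y * ricciEnd h y) c a := by
  set Rc : R4 → Matrix (Fin 4) (Fin 4) ℝ := fun z => Matrix.of fun a b => ricci h a b z with hRc
  have hRs : SmoothMat U Rc := fun a b => H.smooth_ricci a b
  -- Each side lacks only the term with Γ^f_ab of the full covariant derivative. It is symmetric in
  -- a, b and drops out of Yang's equations.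
  have key : ∀ a, pdM a (ricciEnd h) y + conn h a y * ricciEnd h y =
      (h y)⁻¹ * (pdM a Rc y - (conn h a y)ᵀ * Rc y) := by
    intro a
    rw [show ricciEnd h = fun z => (h z)⁻¹ * Rc z from funext fun z => ricciEnd_eq_mul h z,
      pdM_mul H.isOpen H.smooth_inv hRs hy, H.pdM_inv hy]
    noncomm_ring
  rw [key, key, Matrix.mul_apply, Matrix.mul_apply]
  refine Finset.sum_congr rfl fun d _ => ?_
  congr 1
  have h1 := hC y hy a b d
  have hs : ∀ a, pd a (ricci h d b) y = pd a (ricci h b d) y := fun a =>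
    pd_congr (Filter.eventually_of_mem (H.isOpen.mem_nhds hy) fun z hz => H.ricci_symm hz d b) a
  have hs2 : pd b (ricci h d a) y = pd b (ricci h a d) y :=
    pd_congr (Filter.eventually_of_mem (H.isOpen.mem_nhds hy) fun z hz => H.ricci_symm hz d a) b
  simp only [Matrix.sub_apply, pdM, Matrix.mul_apply, Matrix.transpose_apply, hRc, Matrix.of_apply,
    conn]
  change pd a (ricci h d b) y - _ = pd b (ricci h d a) y - _
  rw [hs, hs2]
  simp only [covRicci, Finset.sum_add_distrib, H.christoffel_symm hy _ b a] at h1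
  simp only [H.ricci_symm hy _ b, H.ricci_symm hy _ a]
  linarith

/-- The Ricci scalar of a solution of Yang's equations is constant. -/
theorem pd_scalar_eq_zero (H : IsMetricOn U h) (hC : IsCodazzi U h) (hy : y ∈ U) (e : Fin 4) :
    pd e (scalar h) y = 0 := by
  -- The trace of Yang's equations is ∂_e R = ∇_b R^b_e, whereas the Bianchi identity gives ∂_e R =
  -- 2 ∇_b R^b_e.
  have h1 : ∑ b, (pdM e (ricciEnd h) y + conn h e y * ricciEnd h y) b b =
      ∑ b, (pdM b (ricciEnd h) y + conn h b y * ricciEnd h y) b e :=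
    Finset.sum_congr rfl fun b _ => H.codazzi_ricciEnd hC hy e b b
  simp only [Matrix.add_apply, pdM, Finset.sum_add_distrib, Matrix.mul_apply,
    ← H.pd_scalar hy] at h1
  have h2 := H.bianchi_contracted hy e
  linarith

/-- A Codazzi Ricci tensor satisfies `R^c_fea E^f_b + R^c_fab E^f_e + R^c_fbe E^f_a = 0`. -/
theorem curv_ricciEnd_cyclic (H : IsMetricOn U h) (hC : IsCodazzi U h) (hy : y ∈ U)
    (c e a b : Fin 4) :
    (curv h e a y * ricciEnd h y) c b + (curv h a b y * ricciEnd h y) c e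
      + (curv h b e y * ricciEnd h y) c a = 0 := by
  -- The b-th column of R^a_b is placed in column 0 of an otherwise zero matrix, so that equations
  -- between vectors can use the matrix calculus.
  let X : Fin 4 → R4 → Matrix (Fin 4) (Fin 4) ℝ := fun b z => ricciEnd h z * Matrix.single b 0 1
  have hX : ∀ b, SmoothMat U (X b) := fun b => H.smooth_ricciEnd.mul (SmoothMat.const _)
  have hpX : ∀ z ∈ U, ∀ a b, pdM a (X b) z = pdM a (ricciEnd h) z * Matrix.single b 0 1 := by
    intro z hz a b
    rw [pdM_mul H.isOpen H.smooth_ricciEnd (SmoothMat.const _) hz, pdM_const, Matrix.mul_zero,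
      add_zero]
  have hcol : ∀ (A : Matrix (Fin 4) (Fin 4) ℝ) (c b j : Fin 4),
      (A * (Matrix.single b 0 1 : Matrix (Fin 4) (Fin 4) ℝ)) c j = if j = 0 then A c b else 0 := by
    intro A c b j
    split_ifs with hj
    · subst hj; simp
    · exact Matrix.mul_single_apply_of_ne _ _ _ _ _ hj _
  have hcod : ∀ a b, ∀ z ∈ U, pdM a (X b) z + conn h a z * X b z =
      pdM b (X a) z + conn h b z * X a z := by
    intro a b z hz
    rw [hpX z hz, hpX z hz]
    simp only [X]
    rw [← Matrix.mul_assoc, ← Matrix.add_mul, ← Matrix.mul_assoc, ← Matrix.add_mul]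
    ext c j
    rw [hcol, hcol, H.codazzi_ricciEnd hC hz]
  have hd : ∀ e a b, pdM e (pdM a (X b)) y + (pdM e (conn h a) y * X b y
      + conn h a y * pdM e (X b) y) = pdM e (pdM b (X a)) y + (pdM e (conn h b) y * X a y
      + conn h b y * pdM e (X a) y) := by
    intro e a b
    have := pdM_congr_of_eqOn H.isOpen (hcod a b) hy e
    rwa [pdM_add H.isOpen ((hX b).pdM H.isOpen a) ((H.smooth_conn a).mul (hX b)) hy,
      pdM_add H.isOpen ((hX a).pdM H.isOpen b) ((H.smooth_conn b).mul (hX a)) hy,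
      pdM_mul H.isOpen (H.smooth_conn a) (hX b) hy,
      pdM_mul H.isOpen (H.smooth_conn b) (hX a) hy] at this
  have hfin : curv h e a y * X b y + curv h a b y * X e y + curv h b e y * X a y = 0 := by
    have h1 := hd e a b
    have h2 := hd a b e
    have h3 := hd b e a
    rw [pdM_comm H.isOpen (hX e) hy a b] at h2
    rw [pdM_comm H.isOpen (hX a) hy b e, pdM_comm H.isOpen (hX b) hy e a] at *
    -- In the cyclic sum of the derivatives, second derivatives of X cancel; Yang's equations
    -- multiplied by Γ remove the remaining first derivatives of X, and Ω applied to X is left.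
    have k1 := congrArg (conn h e y * ·) (hcod a b y hy)
    have k2 := congrArg (conn h a y * ·) (hcod b e y hy)
    have k3 := congrArg (conn h b y * ·) (hcod e a y hy)
    simp only [curv_eq]
    rw [← sub_eq_zero] at h1 h2 h3 k1 k2 k3
    have hsum := congrArg₂ (· + ·) (congrArg₂ (· + ·) (congrArg₂ (· + ·) h1 h2) h3)
      (congrArg₂ (· + ·) (congrArg₂ (· + ·) k1 k2) k3)
    simp only [add_zero] at hsum
    rw [← hsum]
    noncomm_ring
  have := congrFun (congrFun hfin c) 0
  simpa [X, ← Matrix.mul_assoc, hcol, Matrix.add_apply] using this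

end IsMetricOn

end Coord

namespace Coord

/-! ### Ricci tensors of the form `λ g_ab + φ v_a v_b` with `v` null -/

/-- At `y`, the Ricci tensor is `λ g_ab + φ v_a v_b` with a nonzero null vector `v` and `φ ≠ 0`. -/
structure IsNullRicciAt (h : R4 → Matrix (Fin 4) (Fin 4) ℝ) (y : R4) (lam φ : ℝ)
    (v : Fin 4 → ℝ) : Prop where
  vec_ne : v ≠ 0
  coeff_ne : φ ≠ 0
  null : v ⬝ᵥ h y *ᵥ v = 0
  ricci_eq : ∀ a b, ricci h a b y = lam * h y a b + φ * ((h y *ᵥ v) a * (h y *ᵥ v) b)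

/-- The contraction of a tensor of rank four with four vectors. -/
def quad (T : Fin 4 → Fin 4 → Fin 4 → Fin 4 → ℝ) (p q r s : Fin 4 → ℝ) : ℝ :=
  ∑ a, ∑ b, ∑ c, ∑ d, T a b c d * (p a * q b * r c * s d)

theorem quad_swap_left (T : Fin 4 → Fin 4 → Fin 4 → Fin 4 → ℝ) (p q r s : Fin 4 → ℝ) :
    quad T p q r s = quad (fun a b c d => T b a c d) q p r s := by
  unfold quad
  rw [Finset.sum_comm]
  exact Finset.sum_congr rfl fun _ _ => Finset.sum_congr rfl fun _ _ =>
    Finset.sum_congr rfl fun _ _ => Finset.sum_congr rfl fun _ _ => by ring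

theorem quad_swap_right (T : Fin 4 → Fin 4 → Fin 4 → Fin 4 → ℝ) (p q r s : Fin 4 → ℝ) :
    quad T p q r s = quad (fun a b c d => T a b d c) p q s r := by
  unfold quad
  refine Finset.sum_congr rfl fun _ _ => Finset.sum_congr rfl fun _ _ => ?_
  rw [Finset.sum_comm]
  exact Finset.sum_congr rfl fun _ _ => Finset.sum_congr rfl fun _ _ => by ring

theorem quad_swap_mid (T : Fin 4 → Fin 4 → Fin 4 → Fin 4 → ℝ) (p q r s : Fin 4 → ℝ) :
    quad T p q r s = quad (fun a b c d => T a c b d) p r q s := by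
  unfold quad
  refine Finset.sum_congr rfl fun _ _ => ?_
  rw [Finset.sum_comm]
  exact Finset.sum_congr rfl fun _ _ => Finset.sum_congr rfl fun _ _ =>
    Finset.sum_congr rfl fun _ _ => by ring

theorem quad_reverse (T : Fin 4 → Fin 4 → Fin 4 → Fin 4 → ℝ) (p q r s : Fin 4 → ℝ) :
    quad T p q r s = quad (fun a b c d => T d c b a) s r q p := by
  rw [quad_swap_left T p q r s, quad_swap_mid _ q p r s, quad_swap_left _ q r p s,
    quad_swap_right _ r q p s, quad_swap_mid _ r q s p, quad_swap_left _ r s q p]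

theorem quad_add (T T' : Fin 4 → Fin 4 → Fin 4 → Fin 4 → ℝ) (p q r s : Fin 4 → ℝ) :
    quad (fun a b c d => T a b c d + T' a b c d) p q r s = quad T p q r s + quad T' p q r s := by
  simp only [quad, add_mul, Finset.sum_add_distrib]

theorem quad_const_mul (x : ℝ) (T : Fin 4 → Fin 4 → Fin 4 → Fin 4 → ℝ) (p q r s : Fin 4 → ℝ) :
    quad (fun a b c d => x * T a b c d) p q r s = x * quad T p q r s := by
  simp only [quad, mul_assoc, Finset.mul_sum]

theorem quad_neg (T : Fin 4 → Fin 4 → Fin 4 → Fin 4 → ℝ) (p q r s : Fin 4 → ℝ) :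
    quad (fun a b c d => -T a b c d) p q r s = -quad T p q r s := by
  simp only [quad, neg_mul, Finset.sum_neg_distrib]

theorem quad_mul_ab_cd (A B : Matrix (Fin 4) (Fin 4) ℝ) (p q r s : Fin 4 → ℝ) :
    quad (fun a b c d => A a b * B c d) p q r s = (p ⬝ᵥ A *ᵥ q) * (r ⬝ᵥ B *ᵥ s) := by
  have inner : ∀ a b, ∑ c, ∑ d, A a b * B c d * (p a * q b * r c * s d) =
      (p a * (A a b * q b)) * (r ⬝ᵥ B *ᵥ s) := by
    intro a b
    simp only [dotProduct, mulVec, Finset.mul_sum]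
    exact Finset.sum_congr rfl fun _ _ => Finset.sum_congr rfl fun _ _ => by ring
  simp only [quad, inner, ← Finset.sum_mul, ← Finset.mul_sum]
  rfl

theorem quad_mul_ac_bd (A B : Matrix (Fin 4) (Fin 4) ℝ) (p q r s : Fin 4 → ℝ) :
    quad (fun a b c d => A a c * B b d) p q r s = (p ⬝ᵥ A *ᵥ r) * (q ⬝ᵥ B *ᵥ s) := by
  rw [quad_swap_mid, quad_mul_ab_cd]

theorem quad_mul_ad_bc (A B : Matrix (Fin 4) (Fin 4) ℝ) (p q r s : Fin 4 → ℝ) :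
    quad (fun a b c d => A a d * B b c) p q r s = (p ⬝ᵥ A *ᵥ s) * (q ⬝ᵥ B *ᵥ r) := by
  rw [quad_swap_right, quad_mul_ac_bd]

/-- The contraction of the Riemann tensor with four vectors. -/
abbrev riem (h : R4 → Matrix (Fin 4) (Fin 4) ℝ) (y : R4) (p q r s : Fin 4 → ℝ) : ℝ :=
  quad (fun a b c d => riemann h a b c d y) p q r s

/-- The Ricci tensor as a matrix. -/
def ricciMat (h : R4 → Matrix (Fin 4) (Fin 4) ℝ) (y : R4) : Matrix (Fin 4) (Fin 4) ℝ :=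
  Matrix.of fun a b => ricci h a b y

theorem quad_weyl (h : R4 → Matrix (Fin 4) (Fin 4) ℝ) (y : R4) (p q r s : Fin 4 → ℝ) :
    quad (fun a b c d => weyl h a b c d y) p q r s = riem h y p q r s
      - (1 / 2) * ((p ⬝ᵥ h y *ᵥ r) * (q ⬝ᵥ ricciMat h y *ᵥ s)
        - (p ⬝ᵥ h y *ᵥ s) * (q ⬝ᵥ ricciMat h y *ᵥ r)
        + (p ⬝ᵥ ricciMat h y *ᵥ r) * (q ⬝ᵥ h y *ᵥ s)
        - (p ⬝ᵥ ricciMat h y *ᵥ s) * (q ⬝ᵥ h y *ᵥ r))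
      + scalar h y / 6 * ((p ⬝ᵥ h y *ᵥ r) * (q ⬝ᵥ h y *ᵥ s)
        - (p ⬝ᵥ h y *ᵥ s) * (q ⬝ᵥ h y *ᵥ r)) := by
  have e : (fun a b c d => weyl h a b c d y) = fun a b c d => riemann h a b c d y
      + ((-(1 / 2)) * (h y a c * ricciMat h y b d) + ((1 / 2) * (h y a d * ricciMat h y b c)
      + ((-(1 / 2)) * (ricciMat h y a c * h y b d) + ((1 / 2) * (ricciMat h y a d * h y b c)
      + ((scalar h y / 6) * (h y a c * h y b d)
        + (-(scalar h y / 6)) * (h y a d * h y b c)))))) := by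
    funext a b c d
    simp only [weyl, ricciMat, Matrix.of_apply]
    ring
  rw [e]
  simp only [quad_add, quad_const_mul, quad_mul_ac_bd, quad_mul_ad_bc]
  ring

/-! ### Curvature identities forced by Yang's equations -/

namespace IsMetricOn

variable {U : Set R4} {h : R4 → Matrix (Fin 4) (Fin 4) ℝ} {y : R4} {lam φ : ℝ} {v : Fin 4 → ℝ}

theorem dot_symm (H : IsMetricOn U h) (hy : y ∈ U) (p q : Fin 4 → ℝ) :
    p ⬝ᵥ h y *ᵥ q = q ⬝ᵥ h y *ᵥ p := by
  rw [Matrix.dotProduct_mulVec, ← Matrix.mulVec_transpose, H.symm y hy, dotProduct_comm]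

theorem lower_ne_zero (H : IsMetricOn U h) (hy : y ∈ U) (hv : v ≠ 0) : h y *ᵥ v ≠ 0 := by
  intro h0
  exact hv (Matrix.eq_zero_of_mulVec_eq_zero (H.det_ne y hy) h0)

theorem exists_dot_ne_zero (H : IsMetricOn U h) (hy : y ∈ U) (hv : v ≠ 0) :
    ∃ w, v ⬝ᵥ h y *ᵥ w ≠ 0 := by
  by_contra! h0
  refine H.lower_ne_zero hy hv (dotProduct_eq_zero _ fun w => ?_)
  rw [dotProduct_comm, H.dot_symm hy, h0]

theorem riem_antisymm_left (H : IsMetricOn U h) (hy : y ∈ U) (p q r s : Fin 4 → ℝ) :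
    riem h y q p r s = -riem h y p q r s := by
  rw [riem, quad_swap_left, ← quad_neg]
  congr 1
  funext a b c d
  exact H.riemann_antisymm_left hy a b c d

theorem riem_antisymm_right (h : R4 → Matrix (Fin 4) (Fin 4) ℝ) (y : R4)
    (p q r s : Fin 4 → ℝ) : riem h y p q s r = -riem h y p q r s := by
  rw [riem, quad_swap_right, ← quad_neg]
  congr 1
  funext a b c d
  exact riemann_antisymm_right h a b c d y

theorem riem_cyclic (H : IsMetricOn U h) (hy : y ∈ U) (p q r s : Fin 4 → ℝ) :
    riem h y p q r s + riem h y p r s q + riem h y p s q r = 0 := by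
  have h1 : riem h y p r s q = quad (fun a b c d => riemann h a c d b y) p q r s := by
    rw [riem, quad_swap_right, quad_swap_mid]
  have h2 : riem h y p s q r = quad (fun a b c d => riemann h a d b c y) p q r s := by
    rw [riem, quad_swap_mid, quad_swap_right]
  rw [h1, h2, riem, ← quad_add, ← quad_add]
  simp [H.riemann_cyclic hy, quad]

theorem ricciEnd_eq (H : IsMetricOn U h) (hy : y ∈ U) (hr : IsNullRicciAt h y lam φ v) :
    ricciEnd h y = lam • (1 : Matrix (Fin 4) (Fin 4) ℝ) + φ • vecMulVec v (h y *ᵥ v) := by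
  have h1 : (Matrix.of fun a b => ricci h a b y) =
      h y * (lam • (1 : Matrix (Fin 4) (Fin 4) ℝ) + φ • vecMulVec v (h y *ᵥ v)) := by
    ext a b
    rw [Matrix.mul_add, Matrix.mul_smul, Matrix.mul_smul, Matrix.mul_vecMulVec]
    simp [hr.ricci_eq, vecMulVec_apply]
  rw [ricciEnd_eq_mul, h1, Matrix.nonsing_inv_mul_cancel_left _ _ (H.isUnit_det hy)]

/-- The part of rank one has trace zero because v is null, so the Ricci scalar determines λ. -/
theorem scalar_eq (H : IsMetricOn U h) (hy : y ∈ U) (hr : IsNullRicciAt h y lam φ v) :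
    scalar h y = 4 * lam := by
  have h1 : scalar h y = Matrix.trace (ricciEnd h y) := rfl
  rw [h1, H.ricciEnd_eq hy hr]
  simp [Matrix.trace_vecMulVec, hr.null, mul_comm]

theorem dot_ricciMat (hr : IsNullRicciAt h y lam φ v) (p q : Fin 4 → ℝ) :
    p ⬝ᵥ ricciMat h y *ᵥ q =
      lam * (p ⬝ᵥ h y *ᵥ q) + φ * ((p ⬝ᵥ h y *ᵥ v) * (q ⬝ᵥ h y *ᵥ v)) := by
  have h1 : ricciMat h y = lam • h y + φ • vecMulVec (h y *ᵥ v) (h y *ᵥ v) := by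
    ext a b
    simp [ricciMat, hr.ricci_eq, vecMulVec_apply]
  rw [h1]
  simp only [add_mulVec, smul_mulVec, dotProduct_add, dotProduct_smul, smul_eq_mul,
    vecMulVec_mulVec, op_smul_eq_smul]
  rw [dotProduct_comm (h y *ᵥ v) q]
  ring

/-- Trilinear extension of an identity between components, contracting one index at a time. -/
theorem dot_cyclic {M : Matrix (Fin 4) (Fin 4) ℝ} {l : Fin 4 → ℝ}
    (hM : ∀ d g i, M d g * l i + M g i * l d + M i d * l g = 0) (e a b : Fin 4 → ℝ) :
    (e ⬝ᵥ M *ᵥ a) * (b ⬝ᵥ l) + (a ⬝ᵥ M *ᵥ b) * (e ⬝ᵥ l) + (b ⬝ᵥ M *ᵥ e) * (a ⬝ᵥ l) = 0 := by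
  have h1 : ∀ g i, (e ᵥ* M) g * l i + M g i * (e ⬝ᵥ l) + (M *ᵥ e) i * l g = 0 := by
    intro g i
    simp only [dotProduct, vecMul, mulVec, Finset.sum_mul, Finset.mul_sum,
      ← Finset.sum_add_distrib]
    exact Finset.sum_eq_zero fun d _ => by linear_combination e d * hM d g i
  have h2 : ∀ i, (e ⬝ᵥ M *ᵥ a) * l i + (a ᵥ* M) i * (e ⬝ᵥ l) + (M *ᵥ e) i * (a ⬝ᵥ l) = 0 := by
    intro i
    rw [dotProduct_mulVec]
    generalize e ᵥ* M = E at *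
    generalize M *ᵥ e = F at *
    generalize e ⬝ᵥ l = x at *
    simp only [dotProduct, vecMul, Finset.sum_mul, Finset.mul_sum, ← Finset.sum_add_distrib]
    exact Finset.sum_eq_zero fun g _ => by linear_combination a g * h1 g i
  rw [dotProduct_mulVec a M b]
  generalize e ⬝ᵥ M *ᵥ a = z at *
  generalize a ᵥ* M = E at *
  generalize M *ᵥ e = F at *
  generalize e ⬝ᵥ l = x at *
  generalize a ⬝ᵥ l = w at *
  simp only [dotProduct, Finset.sum_mul, Finset.mul_sum, ← Finset.sum_add_distrib]
  exact Finset.sum_eq_zero fun i _ => by linear_combination b i * h2 i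

/-- The algebraic consequence `R_acde v^c v_b + R_acdb v^c v_e + ... = 0` of Yang's equations. -/
theorem riem_vec_cyclic (H : IsMetricOn U h) (hC : IsCodazzi U h) (hy : y ∈ U)
    (hr : IsNullRicciAt h y lam φ v) (p e a b : Fin 4 → ℝ) :
    riem h y p v e a * (b ⬝ᵥ h y *ᵥ v) + riem h y p v a b * (e ⬝ᵥ h y *ᵥ v)
      + riem h y p v b e * (a ⬝ᵥ h y *ᵥ v) = 0 := by
  have h1 : ∀ c e a b, (curv h e a y *ᵥ v) c * (h y *ᵥ v) b
      + (curv h a b y *ᵥ v) c * (h y *ᵥ v) e + (curv h b e y *ᵥ v) c * (h y *ᵥ v) a = 0 := by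
    intro c e a b
    have h2 := H.curv_ricciEnd_cyclic hC hy c e a b
    rw [H.ricciEnd_eq hy hr] at h2
    simp only [Matrix.mul_add, Matrix.mul_smul, Matrix.mul_one, Matrix.mul_vecMulVec,
      Matrix.add_apply, Matrix.smul_apply, smul_eq_mul, vecMulVec_apply] at h2
    -- The identity part of R^a_b contributes λ times the first Bianchi identity; the rest carries
    -- the factor φ ≠ 0.
    have h3 := H.riemannUp_cyclic hy c b e a
    simp only [curv] at h2 h3 ⊢
    refine (mul_eq_zero.1 ?_).resolve_left hr.coeff_ne
    linear_combination h2 - lam * h3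
  have h4 : ∀ c e a b, (∑ f, riemann h c f e a y * v f) * (h y *ᵥ v) b
      + (∑ f, riemann h c f a b y * v f) * (h y *ᵥ v) e
      + (∑ f, riemann h c f b e y * v f) * (h y *ᵥ v) a = 0 := by
    intro c e a b
    have h5 : ∀ e a, ∑ f, riemann h c f e a y * v f = ∑ d, h y c d * (curv h e a y *ᵥ v) d := by
      intro e a
      change _ = (h y *ᵥ (curv h e a y *ᵥ v)) c
      rw [mulVec_mulVec]
      simp only [riemann_eq]
      rfl
    simp only [h5, Finset.sum_mul, ← Finset.sum_add_distrib, mul_assoc, ← mul_add, h1]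
    simp
  have h6 : ∀ e a, riem h y p v e a =
      e ⬝ᵥ (Matrix.of fun d g => ∑ c, p c * ∑ f, riemann h c f d g y * v f) *ᵥ a := by
    intro e a
    simp only [riem, quad, dotProduct, mulVec, Matrix.of_apply, Finset.mul_sum, Finset.sum_mul]
    conv_lhs => enter [2, c]; rw [Finset.sum_comm]
    rw [Finset.sum_comm]
    refine Finset.sum_congr rfl fun d _ => ?_
    conv_lhs => enter [2, c]; rw [Finset.sum_comm]
    rw [Finset.sum_comm]
    exact Finset.sum_congr rfl fun _ _ => Finset.sum_congr rfl fun _ _ =>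
      Finset.sum_congr rfl fun _ _ => by ring
  rw [h6, h6, h6]
  refine dot_cyclic (fun d g i => ?_) e a b
  simp only [Matrix.of_apply, Finset.sum_mul, ← Finset.sum_add_distrib]
  refine Finset.sum_eq_zero fun c _ => ?_
  have := h4 c d g i
  simp only [Finset.sum_mul] at this
  rw [mul_assoc, mul_assoc, mul_assoc, ← mul_add, ← mul_add, Finset.sum_mul, Finset.sum_mul,
    Finset.sum_mul, this, mul_zero]

/-- The Riemann tensor contracted twice with `v` is a multiple of `v_a v_d`. -/
theorem exists_riem_vec_vec (H : IsMetricOn U h) (hC : IsCodazzi U h) (hy : y ∈ U)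
    (hr : IsNullRicciAt h y lam φ v) :
    ∃ μ, ∀ p q, riem h y p v v q = μ * ((p ⬝ᵥ h y *ᵥ v) * (q ⬝ᵥ h y *ᵥ v)) := by
  obtain ⟨w, hw⟩ := H.exists_dot_ne_zero hy hr.vec_ne
  rw [H.dot_symm hy] at hw
  -- Inserting v as one of the cyclic arguments loses a term because v·v = 0. This gives
  -- proportionality to q·v; the symmetry in p, q below gives it for p·v.
  have h1 : ∀ p q, riem h y p v v q * (w ⬝ᵥ h y *ᵥ v) = riem h y p v v w * (q ⬝ᵥ h y *ᵥ v) := by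
    intro p q
    have h2 := H.riem_vec_cyclic hC hy hr p v q w
    rw [hr.null, riem_antisymm_right h y p v v w] at h2
    linarith
  have h3 : ∀ p q, riem h y p v v q = riem h y q v v p := by
    intro p q
    rw [riem, quad_reverse]
    congr 1
    funext a b c d
    rw [H.riemann_pair_symm hy, riemann_antisymm_right, H.riemann_antisymm_left hy, neg_neg]
  refine ⟨riem h y w v v w / (w ⬝ᵥ h y *ᵥ v) ^ 2, fun p q => ?_⟩
  have h4 := h1 p q
  have h5 := h1 w p
  rw [h3 w p] at h5
  field_simp
  linear_combination (w ⬝ᵥ h y *ᵥ v) * h4 + (q ⬝ᵥ h y *ᵥ v) * h5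

/-- The Weyl tensor contracted twice with `v` is a multiple of `v_a v_d`. -/
theorem exists_weyl_vec_vec (H : IsMetricOn U h) (hC : IsCodazzi U h) (hy : y ∈ U)
    (hr : IsNullRicciAt h y lam φ v) :
    ∃ μ, ∀ p q, quad (fun a b c d => weyl h a b c d y) p v v q =
      μ * ((p ⬝ᵥ h y *ᵥ v) * (q ⬝ᵥ h y *ᵥ v)) := by
  obtain ⟨μ, hμ⟩ := H.exists_riem_vec_vec hC hy hr
  -- As v is a null Ricci eigenvector, the Ricci terms of the Weyl tensor contribute -λ and the
  -- scalar term R/6.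
  refine ⟨μ - lam + scalar h y / 6, fun p q => ?_⟩
  rw [quad_weyl, hμ]
  simp only [dot_ricciMat hr, hr.null, H.dot_symm hy v q]
  ring

/-- C_abcd v^b v^c = μ v_a v_d, and v_d v_f is killed by antisymmetrisation in d, f. -/
theorem weyl_bel (H : IsMetricOn U h) (hC : IsCodazzi U h) (hy : y ∈ U)
    (hr : IsNullRicciAt h y lam φ v) (a d f : Fin 4) :
    ∑ b, ∑ c, v b * v c * (weyl h a b c d y * (h y *ᵥ v) f - weyl h a b c f y * (h y *ᵥ v) d)
      = 0 := by
  obtain ⟨μ, hμ⟩ := H.exists_weyl_vec_vec hC hy hr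
  have h1 : ∀ d, ∑ b, ∑ c, v b * v c * weyl h a b c d y =
      μ * ((h y *ᵥ v) a * (h y *ᵥ v) d) := by
    intro d
    have := hμ (Pi.single a 1) (Pi.single d 1)
    rw [single_one_dotProduct, single_one_dotProduct] at this
    rw [← this]
    symm
    rw [quad, Finset.sum_eq_single a (fun i _ hi => by simp [hi]) (by simp)]
    refine Finset.sum_congr rfl fun b _ => Finset.sum_congr rfl fun c _ => ?_
    rw [Finset.sum_eq_single d (fun i _ hi => by simp [hi]) (by simp)]
    simp only [Pi.single_eq_same]
    ring
  have h2 : ∀ d f, ∑ b, ∑ c, v b * v c * (weyl h a b c d y * (h y *ᵥ v) f) =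
      μ * ((h y *ᵥ v) a * (h y *ᵥ v) d) * (h y *ᵥ v) f := by
    intro d f
    rw [← h1]
    simp only [Finset.sum_mul, mul_assoc]
  simp only [mul_sub, Finset.sum_sub_distrib, h2]
  ring

/-- `C(v, s, t, n)` is symmetric in `s, t` for orthogonal `s, t` that are orthogonal to `v` and
`n`. -/
theorem weyl_symm (H : IsMetricOn U h) (hC : IsCodazzi U h) (hy : y ∈ U)
    (hr : IsNullRicciAt h y lam φ v) {n s t : Fin 4 → ℝ} (hvn : v ⬝ᵥ h y *ᵥ n ≠ 0)
    (hvs : v ⬝ᵥ h y *ᵥ s = 0) (hvt : v ⬝ᵥ h y *ᵥ t = 0) :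
    quad (fun a b c d => weyl h a b c d y) v t s n =
      quad (fun a b c d => weyl h a b c d y) v s t n := by
  have hsv := (H.dot_symm hy s v).trans hvs
  have htv := (H.dot_symm hy t v).trans hvt
  -- Only R(n, v, s, t)(n·v) survives, so R(n, v, s, t) = 0. The first Bianchi identity then makes
  -- R(v, s, t, n) symmetric in s, t, as are the terms by which the Weyl tensor differs from it.
  have h1 := H.riem_vec_cyclic hC hy hr n s t n
  rw [hsv, htv, mul_zero, mul_zero, add_zero, add_zero, H.dot_symm hy n v] at h1
  have h2 := (mul_eq_zero.1 h1).resolve_right hvn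
  have h3 := H.riem_cyclic hy v s t n
  rw [riem_antisymm_right h y v t s n, H.riem_antisymm_left hy n v s t, h2] at h3
  rw [quad_weyl, quad_weyl]
  simp only [dot_ricciMat hr, hr.null, hvs, hvt, hsv, htv, H.dot_symm hy t s]
  linarith

end IsMetricOn

/-- A Weyl scalar `Ψ₂` is real when `C(k, t, s, n) = C(k, s, t, n)`. -/
theorem conj_psi2 (h : R4 → Matrix (Fin 4) (Fin 4) ℝ) (y : R4) (k n s t : Fin 4 → ℝ)
    (hst : quad (fun a b c d => weyl h a b c d y) k t s n =
      quad (fun a b c d => weyl h a b c d y) k s t n) :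
    psi2 h y k n s t = (starRingEnd ℂ) (psi2 h y k n s t) := by
  have h2 : ((Real.sqrt 2 : ℝ) : ℂ) * ((Real.sqrt 2 : ℝ) : ℂ) = 2 := by
    rw [← Complex.ofReal_mul, Real.mul_self_sqrt (by norm_num)]; norm_num
  have h0 : ((Real.sqrt 2 : ℝ) : ℂ) ≠ 0 := fun h0 => by simp [h0] at h2
  -- From 2 m^b m̄^c = s^b s^c + t^b t^c + i (t^b s^c - s^b t^c).
  have key : psi2 h y k n s t = (((1 / 2) * (quad (fun a b c d => weyl h a b c d y) k s s n
      + quad (fun a b c d => weyl h a b c d y) k t t n) : ℝ) : ℂ)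
      + (((1 / 2) * (quad (fun a b c d => weyl h a b c d y) k t s n
      - quad (fun a b c d => weyl h a b c d y) k s t n) : ℝ) : ℂ) * Complex.I := by
    simp only [psi2, quad, Complex.ofReal_mul, Complex.ofReal_add, Complex.ofReal_sub,
      Complex.ofReal_sum, Finset.mul_sum, Finset.sum_mul, ← Finset.sum_add_distrib,
      ← Finset.sum_sub_distrib]
    refine Finset.sum_congr rfl fun a _ => Finset.sum_congr rfl fun b _ =>
      Finset.sum_congr rfl fun c _ => Finset.sum_congr rfl fun d _ => ?_
    simp only [mVec, map_div₀, map_add, map_mul, Complex.conj_ofReal, Complex.conj_I]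
    field_simp
    push_cast
    rw [sq, h2]
    have hI := Complex.I_sq
    linear_combination (-(weyl h a b c d y : ℂ) * k a * t b * t c * n d) * hI
  rw [key, hst, sub_self, mul_zero, Complex.ofReal_zero, zero_mul, add_zero, Complex.conj_ofReal]

end Coord

/-! ### The covariant derivative of the null eigenvector field -/

namespace Coord

namespace IsMetricOn

variable {U V : Set R4} {h : R4 → Matrix (Fin 4) (Fin 4) ℝ} {K : R4 → Fin 4 → ℝ} {y : R4}

/-- Yang's equations for the vector field that spans the trace-free part of the Ricci tensor. -/
theorem exists_codazzi_field (H : IsMetricOn U h) (hC : IsCodazzi U h) (hV : IsOpen V)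
    (hVU : V ⊆ U) (hK : ∀ i, ContDiffOn ℝ ∞ (fun z => K z i) V)
    (hr : ∀ z ∈ V, ∃ lam φ, IsNullRicciAt h z lam φ (K z)) (hy : y ∈ V) :
    ∃ φ : ℝ, φ ≠ 0 ∧ ∃ D : Fin 4 → Fin 4 → ℝ, ∀ a b c,
      φ * (h y *ᵥ K y) b * covVec h K a c y - φ * (h y *ᵥ K y) a * covVec h K b c y
        + D a b * K y c = 0 := by
  have hE : ∀ z ∈ V, ∃ φ, φ ≠ 0 ∧ ∀ c b, ricciEnd h z c b =
      φ * (K z c * (h z *ᵥ K z) b) + scalar h z * ((1 : Matrix (Fin 4) (Fin 4) ℝ) c b / 4) := by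
    intro z hz
    obtain ⟨lam, φ, hz'⟩ := hr z hz
    refine ⟨φ, hz'.coeff_ne, fun c b => ?_⟩
    rw [H.scalar_eq (hVU hz) hz', H.ricciEnd_eq (hVU hz) hz']
    simp only [Matrix.add_apply, Matrix.smul_apply, vecMulVec_apply, smul_eq_mul]
    ring
  obtain ⟨_, _, hry⟩ := hr y hy
  obtain ⟨i, hi⟩ := Function.ne_iff.1 hry.vec_ne
  have hi : K y i ≠ 0 := hi
  -- φ is given only pointwise, with no regularity. The covector w_b = φ K_b is therefore recovered
  -- as row i of the trace-free Ricci tensor divided by K^i, which is smooth near y.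
  let w : Fin 4 → R4 → ℝ := fun b z =>
    (ricciEnd h z i b - scalar h z * ((1 : Matrix (Fin 4) (Fin 4) ℝ) i b / 4)) / K z i
  have hKd : ∀ c, DifferentiableAt ℝ (fun z => K z c) y :=
    fun c => differentiableAt_of_contDiffOn hV (hK c) hy
  have hsd : DifferentiableAt ℝ (scalar h) y :=
    differentiableAt_of_contDiffOn H.isOpen H.smooth_scalar (hVU hy)
  have hw : ∀ b, DifferentiableAt ℝ (w b) y := by
    intro b
    simp only [w, div_eq_mul_inv _ (K _ i)]
    exact ((H.smooth_ricciEnd.differentiableAt H.isOpen (hVU hy) i b).sub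
      (hsd.mul_const _)).mul ((hKd i).inv hi)
  have hev : ∀ᶠ z in 𝓝 y, ∀ c b, ricciEnd h z c b =
      w b z * K z c + scalar h z * ((1 : Matrix (Fin 4) (Fin 4) ℝ) c b / 4) := by
    filter_upwards [hV.mem_nhds hy, (hKd i).continuousAt.eventually_ne hi] with z hz hiz c b
    obtain ⟨φ, -, hφ⟩ := hE z hz
    simp only [w, hφ]
    field_simp
    ring
  have hpd : ∀ a b c, pd a (fun z => ricciEnd h z c b) y =
      pd a (w b) y * K y c + w b y * pd a (fun z => K z c) y := by
    intro a b c
    rw [pd_congr (hev.mono fun z hz => hz c b), pd_add ((hw b).fun_mul (hKd c)) (hsd.mul_const _),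
      pd_mul (hw b) (hKd c), pd_mul hsd (differentiableAt_const _), pd_const,
      H.pd_scalar_eq_zero hC (hVU hy)]
    ring
  obtain ⟨φ, hφ0, hφ⟩ := hE y hy
  have hwy : ∀ b, w b y = φ * (h y *ᵥ K y) b := by
    intro b
    simp only [w, hφ]
    field_simp
    ring
  -- D is the exterior derivative of w.
  refine ⟨φ, hφ0, fun a b => pd a (w b) y - pd b (w a) y, fun a b c => ?_⟩
  have hgam : ∀ a b, ∑ f, conn h a y c f * ricciEnd h y f b =
      w b y * (∑ f, christoffel h c a f y * K y f)
        + scalar h y * (christoffel h c a b y / 4) := by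
    intro a b
    simp only [hev.self_of_nhds, mul_add, Finset.sum_add_distrib, Finset.mul_sum]
    congr 1
    · exact Finset.sum_congr rfl fun f _ => by rw [conn]; ring
    · rw [Finset.sum_eq_single b (fun j _ hj => by simp [Matrix.one_apply_ne hj]) (by simp),
        Matrix.one_apply_eq, conn]
      ring
  have h1 := H.codazzi_ricciEnd hC (hVU hy) a b c
  simp only [Matrix.add_apply, Matrix.mul_apply] at h1
  rw [hgam, hgam, pdM, pdM, hpd, hpd, H.christoffel_symm (hVU hy) c b a] at h1
  simp only [covVec]
  rw [← hwy, ← hwy]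
  linear_combination h1

/-- The derivative of `K` in a direction orthogonal to `K` is a multiple of `K`. -/
theorem exists_covVec_eq (H : IsMetricOn U h) (hC : IsCodazzi U h) (hV : IsOpen V)
    (hVU : V ⊆ U) (hK : ∀ i, ContDiffOn ℝ ∞ (fun z => K z i) V)
    (hr : ∀ z ∈ V, ∃ lam φ, IsNullRicciAt h z lam φ (K z)) (hy : y ∈ V) {X : Fin 4 → ℝ}
    (hX : X ⬝ᵥ h y *ᵥ K y = 0) :
    ∃ f, ∀ c, ∑ a, X a * covVec h K a c y = f * K y c := by
  obtain ⟨φ, hφ, D, hD⟩ := H.exists_codazzi_field hC hV hVU hK hr hy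
  obtain ⟨_, _, hry⟩ := hr y hy
  obtain ⟨b, hb⟩ := Function.ne_iff.1 (H.lower_ne_zero (hVU hy) hry.vec_ne)
  have hb : (h y *ᵥ K y) b ≠ 0 := hb
  refine ⟨-(∑ a, X a * D a b) / (φ * (h y *ᵥ K y) b), fun c => ?_⟩
  -- Contract with X^a, for a fixed b with K_b ≠ 0; the term with ∇_b K carries X·K = 0.
  have h1 : φ * (h y *ᵥ K y) b * (∑ a, X a * covVec h K a c y)
      - φ * (X ⬝ᵥ h y *ᵥ K y) * covVec h K b c y + (∑ a, X a * D a b) * K y c = 0 := by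
    rw [dotProduct]
    simp only [Finset.sum_mul, Finset.mul_sum, ← Finset.sum_add_distrib, ← Finset.sum_sub_distrib]
    exact Finset.sum_eq_zero fun a _ => by linear_combination X a * hD a b c
  rw [hX] at h1
  field_simp
  linear_combination h1

/-- ∇_X K is a multiple of K, hence orthogonal to Z. Expansion, twist and shear are all combinations
of such contractions. -/
theorem sum_covLow (H : IsMetricOn U h) (hC : IsCodazzi U h) (hV : IsOpen V)
    (hVU : V ⊆ U) (hK : ∀ i, ContDiffOn ℝ ∞ (fun z => K z i) V)
    (hr : ∀ z ∈ V, ∃ lam φ, IsNullRicciAt h z lam φ (K z)) (hy : y ∈ V) {X Z : Fin 4 → ℝ}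
    (hX : X ⬝ᵥ h y *ᵥ K y = 0) (hZ : Z ⬝ᵥ h y *ᵥ K y = 0) :
    ∑ a, ∑ b, covLow h K a b y * (Z a * X b) = 0 := by
  obtain ⟨f, hf⟩ := H.exists_covVec_eq hC hV hVU hK hr hy hX
  have h1 : ∀ a, ∑ b, covLow h K a b y * (Z a * X b) = f * (Z a * (h y *ᵥ K y) a) := by
    intro a
    have h2 : (h y *ᵥ K y) a * f = ∑ c, h y a c * ∑ b, X b * covVec h K b c y := by
      simp only [hf, mulVec, dotProduct, Finset.sum_mul]
      exact Finset.sum_congr rfl fun c _ => by ring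
    rw [show f * (Z a * (h y *ᵥ K y) a) = Z a * ((h y *ᵥ K y) a * f) by ring, h2]
    simp only [covLow, Finset.sum_mul, Finset.mul_sum]
    rw [Finset.sum_comm]
    exact Finset.sum_congr rfl fun c _ => Finset.sum_congr rfl fun b _ => by ring
  simp only [h1, ← Finset.mul_sum]
  rw [show ∑ a, Z a * (h y *ᵥ K y) a = 0 from hZ, mul_zero]

end IsMetricOn

theorem npRho_eq_zero {h : R4 → Matrix (Fin 4) (Fin 4) ℝ} {K : R4 → Fin 4 → ℝ} {y : R4}
    {s t : Fin 4 → ℝ} (hss : ∑ a, ∑ b, covLow h K a b y * (s a * s b) = 0)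
    (hst : ∑ a, ∑ b, covLow h K a b y * (s a * t b) = 0)
    (hts : ∑ a, ∑ b, covLow h K a b y * (t a * s b) = 0)
    (htt : ∑ a, ∑ b, covLow h K a b y * (t a * t b) = 0) : npRho h K y s t = 0 := by
  have key : npRho h K y s t = -((1 / ((Real.sqrt 2 : ℝ) : ℂ)) ^ 2 *
      (((∑ a, ∑ b, covLow h K a b y * (s a * s b) : ℝ) : ℂ)
      - Complex.I * ((∑ a, ∑ b, covLow h K a b y * (s a * t b) : ℝ) : ℂ)
      + Complex.I * ((∑ a, ∑ b, covLow h K a b y * (t a * s b) : ℝ) : ℂ)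
      - Complex.I ^ 2 * ((∑ a, ∑ b, covLow h K a b y * (t a * t b) : ℝ) : ℂ))) := by
    simp only [npRho, Complex.ofReal_sum, Finset.mul_sum, ← Finset.sum_add_distrib,
      ← Finset.sum_sub_distrib, mVec, map_div₀, map_add, map_mul, Complex.conj_ofReal,
      Complex.conj_I]
    congr 1
    exact Finset.sum_congr rfl fun a _ => Finset.sum_congr rfl fun b _ => by push_cast; ring
  rw [key, hss, hst, hts, htt]
  simp

theorem npSigma_eq_zero {h : R4 → Matrix (Fin 4) (Fin 4) ℝ} {K : R4 → Fin 4 → ℝ} {y : R4}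
    {s t : Fin 4 → ℝ} (hss : ∑ a, ∑ b, covLow h K a b y * (s a * s b) = 0)
    (hst : ∑ a, ∑ b, covLow h K a b y * (s a * t b) = 0)
    (hts : ∑ a, ∑ b, covLow h K a b y * (t a * s b) = 0)
    (htt : ∑ a, ∑ b, covLow h K a b y * (t a * t b) = 0) : npSigma h K y s t = 0 := by
  have key : npSigma h K y s t = -((1 / ((Real.sqrt 2 : ℝ) : ℂ)) ^ 2 *
      (((∑ a, ∑ b, covLow h K a b y * (s a * s b) : ℝ) : ℂ)
      + Complex.I * ((∑ a, ∑ b, covLow h K a b y * (s a * t b) : ℝ) : ℂ)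
      + Complex.I * ((∑ a, ∑ b, covLow h K a b y * (t a * s b) : ℝ) : ℂ)
      + Complex.I ^ 2 * ((∑ a, ∑ b, covLow h K a b y * (t a * t b) : ℝ) : ℂ))) := by
    simp only [npSigma, Complex.ofReal_sum, Finset.mul_sum, ← Finset.sum_add_distrib,
      mVec]
    congr 1
    exact Finset.sum_congr rfl fun a _ => Finset.sum_congr rfl fun b _ => by push_cast; ring
  rw [key, hss, hst, hts, htt]
  simp

end Coord

/-! ### Components of tangent vectors and of bilinear forms -/

section ChartComponents

variable {M : Type*} [TopologicalSpace M] [ChartedSpace R4 M]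
  {e : OpenPartialHomeomorph M R4} {x : M}

theorem IsChart.mdifferentiable (he : IsChart e) : e.MDifferentiable 𝓘(ℝ, R4) 𝓘(ℝ, R4) :=
  ⟨(contMDiffOn_of_mem_maximalAtlas he).mdifferentiableOn (by simp),
    (contMDiffOn_symm_of_mem_maximalAtlas he).mdifferentiableOn (by simp)⟩

theorem isChart_chartAt [IsManifold 𝓘(ℝ, R4) ∞ M] (x : M) : IsChart (chartAt R4 x) :=
  IsManifold.chart_mem_maximalAtlas x

/-- The components of tangent vectors at `x` in the chart `e`, as a linear equivalence. -/
def compEquiv (he : IsChart e) (hx : x ∈ e.source) : Tan x ≃ₗ[ℝ] (Fin 4 → ℝ) :=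
  (he.mdifferentiable.mfderiv hx).toLinearEquiv ≪≫ₗ WithLp.linearEquiv 2 ℝ (Fin 4 → ℝ)

theorem compEquiv_apply (he : IsChart e) (hx : x ∈ e.source) (v : Tan x) :
    compEquiv he hx v = vecComp e x v := rfl

theorem vecComp_ne_zero (he : IsChart e) (hx : x ∈ e.source) {v : Tan x} (hv : v ≠ 0) :
    vecComp e x v ≠ 0 := by
  rw [← compEquiv_apply he hx]
  simpa using hv

theorem coordVec_eq (he : IsChart e) {y : R4} (hy : y ∈ e.target) (i : Fin 4) :
    coordVec e y i = (compEquiv he (e.map_target hy)).symm (Pi.single i 1) := by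
  rw [LinearEquiv.eq_symm_apply]
  have h1 := he.mdifferentiable.comp_symm_deriv hy
  have h2 := DFunLike.congr_fun h1 (EuclideanSpace.single i (1 : ℝ) : R4)
  have h3 : (compEquiv he (e.map_target hy)) (coordVec e y i) =
      WithLp.linearEquiv 2 ℝ (Fin 4 → ℝ) (EuclideanSpace.single i (1 : ℝ)) := by
    exact congrArg (WithLp.linearEquiv 2 ℝ (Fin 4 → ℝ)) h2
  rw [h3]
  rfl

theorem formComp_eq (he : IsChart e) (hx : x ∈ e.source)
    (B : ∀ x : M, LinearMap.BilinForm ℝ (Tan x)) (i j : Fin 4) :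
    formComp e B (e x) i j = B x ((compEquiv he hx).symm (Pi.single i 1))
      ((compEquiv he hx).symm (Pi.single j 1)) := by
  obtain ⟨y, hy, rfl⟩ : ∃ y ∈ e.target, e.symm y = x := ⟨e x, e.map_source hx, e.left_inv hx⟩
  rw [e.right_inv hy, formComp, coordVec_eq he hy, coordVec_eq he hy]

theorem form_apply (he : IsChart e) (hx : x ∈ e.source)
    (B : ∀ x : M, LinearMap.BilinForm ℝ (Tan x)) (u w : Tan x) :
    B x u w = vecComp e x u ⬝ᵥ formComp e B (e x) *ᵥ vecComp e x w := by
  let b := Module.Basis.ofEquivFun (compEquiv he hx)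
  have hb : ∀ i, b i = (compEquiv he hx).symm (Pi.single i 1) := fun i => by
    simp [b, Module.Basis.coe_ofEquivFun]
  have hu : ∀ u : Tan x, u = ∑ i, vecComp e x u i • b i := fun u => (b.sum_equivFun u).symm
  conv_lhs => rw [hu u, hu w]
  simp only [map_sum, LinearMap.sum_apply, map_smul, LinearMap.smul_apply, smul_eq_mul, hb,
    ← formComp_eq he hx, dotProduct, mulVec, Finset.mul_sum]
  rw [Finset.sum_comm]
  exact Finset.sum_congr rfl fun _ _ => Finset.sum_congr rfl fun _ _ => by ring

/-- The matrix whose columns are the components of a basis. -/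
def basisMat (e : OpenPartialHomeomorph M R4) (b : Module.Basis (Fin 4) ℝ (Tan x)) :
    Matrix (Fin 4) (Fin 4) ℝ :=
  Matrix.of fun i j => vecComp e x (b j) i

theorem basisMat_transpose_mul (he : IsChart e) (hx : x ∈ e.source)
    (B : ∀ x : M, LinearMap.BilinForm ℝ (Tan x)) (b : Module.Basis (Fin 4) ℝ (Tan x)) :
    (basisMat e b)ᵀ * formComp e B (e x) * basisMat e b =
      Matrix.of fun i j => B x (b i) (b j) := by
  ext i j
  rw [Matrix.of_apply, form_apply he hx, Matrix.mul_assoc, Matrix.mul_apply]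
  rfl

theorem basisMat_mulVec (he : IsChart e) (hx : x ∈ e.source)
    (b : Module.Basis (Fin 4) ℝ (Tan x)) (c : Fin 4 → ℝ) :
    basisMat e b *ᵥ c = vecComp e x (∑ j, c j • b j) := by
  rw [← compEquiv_apply he hx]
  ext i
  simp [basisMat, mulVec, dotProduct, compEquiv_apply, mul_comm]

end ChartComponents

namespace LorentzMetric

variable {M : Type*} [TopologicalSpace M] [ChartedSpace R4 M] [IsManifold 𝓘(ℝ, R4) ∞ M]
  {g : LorentzMetric M} {e : OpenPartialHomeomorph M R4} {x : M}

theorem form_eq_dot (g : LorentzMetric M) (he : IsChart e) (hx : x ∈ e.source) (u w : Tan x) :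
    g.form x u w = vecComp e x u ⬝ᵥ g.comp e (e x) *ᵥ vecComp e x w :=
  form_apply he hx g.form u w

/-- The Minkowski metric. -/
def eta : Matrix (Fin 4) (Fin 4) ℝ := Matrix.diagonal fun i => if i = 0 then -1 else 1

theorem eta_mul_eta : eta * eta = 1 := by
  rw [eta, Matrix.diagonal_mul_diagonal, ← Matrix.diagonal_one]
  congr 1
  funext i
  split_ifs <;> norm_num

/-- One orthonormal basis serves all charts at once, so vectors built from it do not depend on the
chart. -/
theorem exists_basisMat (g : LorentzMetric M) (x : M) :
    ∃ b : Module.Basis (Fin 4) ℝ (Tan x), ∀ e : OpenPartialHomeomorph M R4, IsChart e →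
      x ∈ e.source → (basisMat e b)ᵀ * g.comp e (e x) * basisMat e b = eta := by
  obtain ⟨b, hb⟩ := g.signature x
  refine ⟨b, fun e he hx => (basisMat_transpose_mul he hx g.form b).trans ?_⟩
  ext i j
  simp [hb, eta, Matrix.diagonal_apply]

theorem isMetricOn (g : LorentzMetric M) (he : IsChart e) :
    Coord.IsMetricOn e.target (g.comp e) where
  isOpen := e.open_target
  smooth := g.smooth e he
  symm y hy := by
    ext i j
    exact g.symm _ _ _
  det_ne y hy h0 := by
    obtain ⟨b, hb⟩ := g.exists_basisMat (e.symm y)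
    have h1 := congrArg Matrix.det (hb e he (e.map_target hy))
    rw [e.right_inv hy, Matrix.det_mul, Matrix.det_mul, h0] at h1
    have h2 := congrArg Matrix.det eta_mul_eta
    rw [Matrix.det_mul, ← h1] at h2
    simp at h2

/-! ### The algebraic type of the Ricci tensor -/

/-- The Ricci tensor at `x` is `λ g_ab + φ v_a v_b` with a nonzero null vector `v` and `φ ≠ 0`. -/
def IsNullRicci (g : LorentzMetric M) (x : M) (lam φ : ℝ) (v : Tan x) : Prop :=
  ∀ e : OpenPartialHomeomorph M R4, IsChart e → x ∈ e.source →
    Coord.IsNullRicciAt (g.comp e) (e x) lam φ (vecComp e x v)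

theorem exists_form_ne_zero (g : LorentzMetric M) {v : Tan x} (hv : v ≠ 0) :
    ∃ w, g.form x v w ≠ 0 := by
  have hx := mem_chart_source R4 x
  have he := isChart_chartAt x
  obtain ⟨p, hp⟩ := (g.isMetricOn he).exists_dot_ne_zero ((chartAt R4 x).map_source hx)
    (vecComp_ne_zero he hx hv)
  refine ⟨(compEquiv he hx).symm p, ?_⟩
  rwa [g.form_eq_dot he hx, ← compEquiv_apply he hx (LinearEquiv.symm _ _),
    LinearEquiv.apply_symm_apply]

theorem exists_form_eq (g : LorentzMetric M) {v : Tan x} (hv : v ≠ 0) (c : ℝ) :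
    ∃ w, g.form x v w = c := by
  obtain ⟨w, hw⟩ := g.exists_form_ne_zero hv
  exact ⟨(c / g.form x v w) • w, by simp [hw]⟩

/-- Self-adjointness for g, a consequence of the symmetry of R_ab; it ties the Jordan form to the
metric. -/
theorem ricciEnd_mulVec {h : R4 → Matrix (Fin 4) (Fin 4) ℝ} {U : Set R4} {y : R4}
    (H : Coord.IsMetricOn U h) (hy : y ∈ U) (p q : Fin 4 → ℝ) :
    q ⬝ᵥ h y *ᵥ (Coord.ricciEnd h y *ᵥ p) = p ⬝ᵥ h y *ᵥ (Coord.ricciEnd h y *ᵥ q) := by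
  have h1 : (h y * Coord.ricciEnd h y)ᵀ = h y * Coord.ricciEnd h y := by
    ext a b
    rw [Matrix.transpose_apply, H.mul_ricciEnd_apply hy, H.mul_ricciEnd_apply hy, H.ricci_symm hy]
  rw [mulVec_mulVec, mulVec_mulVec, Matrix.dotProduct_mulVec, ← Matrix.mulVec_transpose, h1,
    dotProduct_comm]

namespace IsNullRicci

variable {lam φ : ℝ} {v : Tan x}

theorem vec_ne (hr : g.IsNullRicci x lam φ v) : v ≠ 0 := by
  rintro rfl
  have hx := mem_chart_source R4 x
  refine (hr _ (isChart_chartAt x) hx).vec_ne ?_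
  rw [← compEquiv_apply (isChart_chartAt x) hx, map_zero]

theorem coeff_ne (hr : g.IsNullRicci x lam φ v) : φ ≠ 0 :=
  (hr _ (isChart_chartAt x) (mem_chart_source R4 x)).coeff_ne

theorem null (hr : g.IsNullRicci x lam φ v) : g.form x v v = 0 := by
  have hx := mem_chart_source R4 x
  rw [g.form_eq_dot (isChart_chartAt x) hx]
  exact (hr _ (isChart_chartAt x) hx).null

/-- φ absorbs the scale of v, so only the line of v matters. -/
theorem smul (hr : g.IsNullRicci x lam φ v) {c : ℝ} (hc : c ≠ 0) :
    g.IsNullRicci x lam (φ / c ^ 2) (c • v) := by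
  intro e he hx
  have h1 := hr e he hx
  rw [← compEquiv_apply he hx, map_smul, compEquiv_apply]
  refine ⟨smul_ne_zero hc h1.vec_ne, div_ne_zero h1.coeff_ne (pow_ne_zero 2 hc), ?_, fun a b => ?_⟩
  · simp [mulVec_smul, h1.null]
  · rw [h1.ricci_eq, mulVec_smul, Pi.smul_apply, Pi.smul_apply, smul_eq_mul, smul_eq_mul]
    field_simp

/-- The Ricci endomorphism is `w ↦ λ w + φ g(v, w) v`. -/
theorem ricciMapsTo (hr : g.IsNullRicci x lam φ v) (w : Tan x) :
    g.RicciMapsTo x w (lam • w + (φ * g.form x v w) • v) := by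
  intro e he hx
  rw [(g.isMetricOn he).ricciEnd_eq (e.map_source hx) (hr e he hx), ← compEquiv_apply he hx,
    ← compEquiv_apply he hx, ← compEquiv_apply he hx (lam • w + _), map_add, map_smul, map_smul, add_mulVec, smul_mulVec, smul_mulVec,
    one_mulVec, vecMulVec_mulVec, op_smul_eq_smul, smul_smul, g.symm, g.form_eq_dot he hx,
    compEquiv_apply, compEquiv_apply, dotProduct_comm]

theorem ricciMapsTo_iff (hr : g.IsNullRicci x lam φ v) (w z : Tan x) :
    g.RicciMapsTo x w z ↔ z = lam • w + (φ * g.form x v w) • v := by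
  refine ⟨fun hz => ?_, fun hz => hz ▸ hr.ricciMapsTo w⟩
  have hx := mem_chart_source R4 x
  have he := isChart_chartAt x
  apply (compEquiv he hx).injective
  exact (hz _ he hx).symm.trans (hr.ricciMapsTo w _ he hx)

/-- R^a_b - λ has image the line of v. An eigenvector for a different eigenvalue would lie in this
image too, so the eigenvalue need not be identified beforehand. -/
theorem isDoubleNullEigenvector_iff (hr : g.IsNullRicci x lam φ v) {u : Tan x} (hu : u ≠ 0) :
    g.IsDoubleNullEigenvector x u ↔ u ∈ Submodule.span ℝ {v} := by
  rw [Submodule.mem_span_singleton]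
  constructor
  · rintro ⟨-, -, lam', w, h1, h2⟩
    rw [hr.ricciMapsTo_iff] at h1 h2
    by_cases hl : lam' = lam
    · refine ⟨φ * g.form x v w, ?_⟩
      rw [hl] at h2
      exact (add_left_cancel h2).symm
    · refine ⟨(lam' - lam)⁻¹ * (φ * g.form x v u), ?_⟩
      rw [mul_smul, inv_smul_eq_iff₀ (sub_ne_zero.2 hl), sub_smul, h1]
      abel
  · rintro ⟨c, rfl⟩
    obtain ⟨w, hw⟩ := g.exists_form_eq hr.vec_ne (c / φ)
    refine ⟨hu, by simp [hr.null], lam, w, ?_, ?_⟩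
    · rw [hr.ricciMapsTo_iff]
      simp [hr.null]
    · rw [hr.ricciMapsTo_iff, hw, mul_div_cancel₀ _ hr.coeff_ne]

/-- Jordan basis: v is completed to a basis of its three-dimensional orthogonal complement, the
λ-eigenspace, and w with φ g(v, w) = 1 is added. -/
theorem isSegre211 (hr : g.IsNullRicci x lam φ v) : g.IsSegre211 x lam := by
  have hx := mem_chart_source R4 x
  have he := isChart_chartAt x
  have hfin : Module.finrank ℝ (Tan x) = 4 := by
    rw [(compEquiv he hx).finrank_eq]; simp
  have : FiniteDimensional ℝ (Tan x) := Module.finite_of_finrank_pos (by omega)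
  obtain ⟨w, hw⟩ := g.exists_form_eq hr.vec_ne φ⁻¹
  have hw0 : g.form x v w ≠ 0 := by rw [hw]; exact inv_ne_zero hr.coeff_ne
  have hker : Module.finrank ℝ (LinearMap.ker (g.form x v)) = 3 := by
    have h1 := (g.form x v).finrank_range_add_finrank_ker
    have h2 : LinearMap.range (g.form x v) = ⊤ :=
      LinearMap.range_eq_top.2 fun c => g.exists_form_eq hr.vec_ne c
    rw [h2, finrank_top, Module.finrank_self, hfin] at h1
    omega
  let v' : LinearMap.ker (g.form x v) := ⟨v, hr.null⟩
  have hv' : v' ≠ 0 := fun h0 => hr.vec_ne (congrArg Subtype.val h0)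
  have hl1 : LinearIndependent ℝ ![v'] := by
    rw [linearIndependent_unique_iff]; simpa using hv'
  obtain ⟨p, hp⟩ := exists_linearIndependent_cons_of_lt_finrank hl1 (by omega)
  obtain ⟨q, hq⟩ := exists_linearIndependent_cons_of_lt_finrank hp (by omega)
  have hq' := hq.map' (LinearMap.ker (g.form x v)).subtype (Submodule.ker_subtype _)
  have hl4 : LinearIndependent ℝ (Fin.cons w
      ((LinearMap.ker (g.form x v)).subtype ∘ Fin.cons q (Fin.cons p ![v'])) :
        Fin 4 → Tan x) := by
    refine hq'.finCons fun hmem => hw0 ?_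
    have : Submodule.span ℝ (Set.range ((LinearMap.ker (g.form x v)).subtype ∘
        Fin.cons q (Fin.cons p ![v']))) ≤ LinearMap.ker (g.form x v) := by
      rw [Submodule.span_le]
      rintro _ ⟨i, rfl⟩
      exact Subtype.property _
    exact this hmem
  -- The basis arises in the order w, q, p, v; the permutation makes it v, w, p, q.
  let b := (basisOfLinearIndependentOfCardEqFinrank hl4 (by simp [hfin])).reindex
    (Equiv.swap 0 3 * Equiv.swap 0 1)
  have hb : ∀ i, b ((Equiv.swap 0 3 * Equiv.swap 0 1 : Equiv.Perm (Fin 4)) i) = (Fin.cons w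
      ((LinearMap.ker (g.form x v)).subtype ∘ Fin.cons q (Fin.cons p ![v'])) :
        Fin 4 → Tan x) i := by
    intro i
    rw [Module.Basis.reindex_apply, Equiv.symm_apply_apply,
      coe_basisOfLinearIndependentOfCardEqFinrank]
  have hb0 : b 0 = v := (hb 3)
  have hb1 : b 1 = w := (hb 0)
  have hb2 : b 2 = p := (hb 2)
  have hb3 : b 3 = q := (hb 1)
  refine ⟨b, ?_, ?_, ?_, ?_⟩ <;> rw [hr.ricciMapsTo_iff]
  · simp [hb0, hr.null]
  · rw [hb1, hb0, hw, mul_inv_cancel₀ hr.coeff_ne, one_smul]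
  · have : g.form x v p = 0 := p.2
    simp [hb2, this]
  · have : g.form x v q = 0 := q.2
    simp [hb3, this]

end IsNullRicci

/-- R^a_b acts as u ↦ λ u + u¹ b₀, where u¹ is the b₁-coordinate. Self-adjointness gives u¹ g(b₁,
b₀) = g(u, b₀), and g(b₁, b₀) ≠ 0 by nondegeneracy, so φ = 1 / g(b₁, b₀) and v = b₀. This v is null
because its own b₁-coordinate is zero. -/
theorem IsSegre211.exists_isNullRicci {lam : ℝ} (hs : g.IsSegre211 x lam) :
    ∃ φ v, g.IsNullRicci x lam φ v := by
  obtain ⟨b, h0, h1, h2, h3⟩ := hs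
  have hE : ∀ e : OpenPartialHomeomorph M R4, IsChart e → x ∈ e.source → ∀ u,
      Coord.ricciEnd (g.comp e) (e x) *ᵥ vecComp e x u =
        vecComp e x (lam • u + b.repr u 1 • b 0) := by
    intro e he hx u
    have key : (Coord.ricciEnd (g.comp e) (e x)).mulVecLin ∘ₗ (compEquiv he hx).toLinearMap =
        (compEquiv he hx).toLinearMap ∘ₗ
          (lam • LinearMap.id + (b.coord 1).smulRight (b 0)) := by
      refine b.ext fun i => ?_
      simp only [LinearMap.comp_apply, LinearEquiv.coe_coe, mulVecLin_apply, compEquiv_apply,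
        LinearMap.add_apply, LinearMap.smul_apply, LinearMap.id_apply, LinearMap.smulRight_apply,
        Module.Basis.coord_apply, Module.Basis.repr_self]
      fin_cases i
      · simpa using h0 e he hx
      · simpa using h1 e he hx
      · simpa using h2 e he hx
      · simpa using h3 e he hx
    exact DFunLike.congr_fun key u
  have hx := mem_chart_source R4 x
  have he := isChart_chartAt x
  have hsymm : ∀ u w, b.repr u 1 * g.form x w (b 0) = b.repr w 1 * g.form x u (b 0) := by
    intro u w
    have h4 := ricciEnd_mulVec (g.isMetricOn he) ((chartAt R4 x).map_source hx)
      (vecComp (chartAt R4 x) x u) (vecComp (chartAt R4 x) x w)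
    rw [hE _ he hx, hE _ he hx, ← g.form_eq_dot he hx, ← g.form_eq_dot he hx] at h4
    simp only [map_add, map_smul, smul_eq_mul, g.symm x w u] at h4
    linarith
  have hu : ∀ u, b.repr u 1 * g.form x (b 1) (b 0) = g.form x u (b 0) := by
    intro u
    simpa using hsymm u (b 1)
  have hc : g.form x (b 1) (b 0) ≠ 0 := by
    intro hc
    obtain ⟨w, hw⟩ := g.exists_form_ne_zero (b.ne_zero 0)
    rw [g.symm, ← hu, hc, mul_zero] at hw
    exact hw rfl
  refine ⟨(g.form x (b 1) (b 0))⁻¹, b 0, fun e he hx => ⟨vecComp_ne_zero he hx (b.ne_zero 0),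
    inv_ne_zero hc, ?_, fun i j => ?_⟩⟩
  · rw [← g.form_eq_dot he hx, ← hu]
    simp
  · rw [← (g.isMetricOn he).mul_ricciEnd_apply (e.map_source hx)]
    have h5 := hE e he hx ((compEquiv he hx).symm (Pi.single j 1))
    rw [← compEquiv_apply he hx, ← compEquiv_apply he hx, map_add, map_smul, map_smul,
      LinearEquiv.apply_symm_apply] at h5
    have h6 : b.repr ((compEquiv he hx).symm (Pi.single j 1)) 1 =
        (g.form x (b 1) (b 0))⁻¹ * (g.comp e (e x) *ᵥ vecComp e x (b 0)) j := by
      rw [eq_inv_mul_iff_mul_eq₀ hc, mul_comm, hu, g.form_eq_dot he hx,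
        ← compEquiv_apply he hx, LinearEquiv.apply_symm_apply, single_one_dotProduct]
    have h7 := congrFun (congrArg (g.comp e (e x) *ᵥ ·) h5) i
    simp only [mulVec_add, mulVec_smul, mulVec_single_one, Pi.add_apply,
      Pi.smul_apply, smul_eq_mul, Matrix.col_apply, h6, compEquiv_apply] at h7
    exact h7.trans (by ring)

theorem isSegre211_iff {lam : ℝ} :
    g.IsSegre211 x lam ↔ ∃ φ v, g.IsNullRicci x lam φ v :=
  ⟨IsSegre211.exists_isNullRicci, fun ⟨_, _, hr⟩ => hr.isSegre211⟩

end LorentzMetric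

namespace Coord

/-- Einstein's equations for pure radiation fix the Ricci scalar. -/
theorem IsMetricOn.isNullRicciAt_of_einstein {U : Set R4} {h : R4 → Matrix (Fin 4) (Fin 4) ℝ}
    {y : R4} (H : IsMetricOn U h) (hy : y ∈ U) {Lam φ : ℝ} {v : Fin 4 → ℝ} (hv : v ≠ 0)
    (hφ : φ ≠ 0) (hn : v ⬝ᵥ h y *ᵥ v = 0)
    (hE : ∀ a b, ricci h a b y - (1 / 2) * scalar h y * h y a b + Lam * h y a b =
      φ * ((h y *ᵥ v) a * (h y *ᵥ v) b)) : IsNullRicciAt h y Lam φ v := by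
  -- Read with the eigenvalue R/2 - Λ, the trace is R = 4(R/2 - Λ), so R = 4Λ and the eigenvalue is
  -- Λ.
  have h1 : IsNullRicciAt h y ((1 / 2) * scalar h y - Lam) φ v :=
    ⟨hv, hφ, hn, fun a b => by linear_combination hE a b⟩
  have h2 := H.scalar_eq hy h1
  have h3 : scalar h y = 4 * Lam := by linarith
  refine ⟨hv, hφ, hn, fun a b => ?_⟩
  rw [h1.ricci_eq, h3]
  ring

theorem IsMetricOn.einstein_of_isNullRicciAt {U : Set R4} {h : R4 → Matrix (Fin 4) (Fin 4) ℝ}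
    {y : R4} (H : IsMetricOn U h) (hy : y ∈ U) {Lam φ : ℝ} {v : Fin 4 → ℝ}
    (hr : IsNullRicciAt h y Lam φ v) (a b : Fin 4) :
    ricci h a b y - (1 / 2) * scalar h y * h y a b + Lam * h y a b =
      φ * ((h y *ᵥ v) a * (h y *ᵥ v) b) := by
  rw [hr.ricci_eq, H.scalar_eq hy hr]
  ring

/-! ### Null electromagnetic fields -/

theorem sum_inv_mul_eq_trace (G F : Matrix (Fin 4) (Fin 4) ℝ) :
    ∑ a, ∑ b, ∑ a', ∑ b', G⁻¹ a a' * G⁻¹ b b' * F a b * F a' b' =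
      (G⁻¹ * (F * G⁻¹ * Fᵀ)ᵀ).trace := by
  simp only [Matrix.trace, Matrix.diag_apply, Matrix.mul_apply, Matrix.transpose_apply,
    Finset.mul_sum, Finset.sum_mul]
  refine Finset.sum_congr rfl fun a _ => ?_
  rw [Finset.sum_comm]
  refine Finset.sum_congr rfl fun a' _ => ?_
  rw [Finset.sum_comm]
  exact Finset.sum_congr rfl fun _ _ => Finset.sum_congr rfl fun _ _ => by ring

theorem emStress_eq {G F : Matrix (Fin 4) (Fin 4) ℝ} (hF : IsNullForm G F) :
    (Matrix.of fun a b => emStress G F a b) = F * G⁻¹ * Fᵀ := by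
  ext a b
  rw [Matrix.of_apply, emStress, hF.2.1, mul_zero, sub_zero, Matrix.mul_apply, Finset.sum_comm]
  refine Finset.sum_congr rfl fun d _ => ?_
  rw [Matrix.mul_apply, Finset.sum_mul]
  exact Finset.sum_congr rfl fun c _ => by rw [Matrix.transpose_apply]; ring

/-- The square of the Pfaffian. It carries F_ab ⋆F^ab = 0 from a chart to a frame, since
determinants transform simply. -/
theorem det_of_antisymm {F : Matrix (Fin 4) (Fin 4) ℝ} (hF : Fᵀ = -F) :
    F.det = (F 0 1 * F 2 3 - F 0 2 * F 1 3 + F 0 3 * F 1 2) ^ 2 := by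
  have h1 : ∀ i j, F j i = -F i j := fun i j => congrFun (congrFun hF i) j
  have h0 : ∀ i, F i i = 0 := fun i => by linarith [h1 i i]
  rw [Matrix.det_succ_row_zero]
  simp only [Fin.sum_univ_succ, Matrix.det_fin_three, Matrix.submatrix_apply]
  simp [Fin.succAbove, h0, h1 0 1, h1 0 2, h1 0 3, h1 1 2, h1 1 3, h1 2 3]
  ring

/-- In an orthonormal frame, the stress of a null electromagnetic field is that of pure
radiation. -/
theorem exists_null_stress {F : Matrix (Fin 4) (Fin 4) ℝ} (hF : Fᵀ = -F) (hF0 : F ≠ 0)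
    (hp : F 0 1 * F 2 3 - F 0 2 * F 1 3 + F 0 3 * F 1 2 = 0)
    (ht : (LorentzMetric.eta * (F * LorentzMetric.eta * Fᵀ)ᵀ).trace = 0) :
    ∃ (φ : ℝ) (κ : Fin 4 → ℝ), φ ≠ 0 ∧ κ ≠ 0 ∧ κ ⬝ᵥ LorentzMetric.eta *ᵥ κ = 0 ∧
      F * LorentzMetric.eta * Fᵀ = φ • vecMulVec κ κ := by
  have h1 : ∀ i j, F j i = -F i j := fun i j => congrFun (congrFun hF i) j
  have h0 : ∀ i, F i i = 0 := fun i => by linarith [h1 i i]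
  have hT : ∀ i j, (F * LorentzMetric.eta * Fᵀ) i j =
      -(F i 0 * F j 0) + F i 1 * F j 1 + F i 2 * F j 2 + F i 3 * F j 3 := by
    intro i j
    simp [Matrix.mul_apply, LorentzMetric.eta, Fin.sum_univ_four, Matrix.diagonal_apply]
  -- With E = (a, b, c) and B = (p, -q, r) in the notation below, this is |E|² = |B|², while `hp` is
  -- E·B = 0.
  have ht' : (F 0 1) ^ 2 + (F 0 2) ^ 2 + (F 0 3) ^ 2
      = (F 2 3) ^ 2 + (F 1 3) ^ 2 + (F 1 2) ^ 2 := by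
    have : (LorentzMetric.eta * (F * LorentzMetric.eta * Fᵀ)ᵀ).trace =
        -(F * LorentzMetric.eta * Fᵀ) 0 0 + (F * LorentzMetric.eta * Fᵀ) 1 1
          + (F * LorentzMetric.eta * Fᵀ) 2 2 + (F * LorentzMetric.eta * Fᵀ) 3 3 := by
      generalize F * LorentzMetric.eta * Fᵀ = T
      simp [Matrix.trace, Matrix.mul_apply, LorentzMetric.eta, Fin.sum_univ_four,
        Matrix.diagonal_apply]
    rw [this] at ht
    simp only [hT, h0, h1 0 1, h1 0 2, h1 0 3, h1 1 2, h1 1 3, h1 2 3] at ht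
    linarith
  set a := F 0 1
  set b := F 0 2
  set c := F 0 3
  set p := F 2 3
  set q := F 1 3
  set r := F 1 2
  have hw : a ^ 2 + b ^ 2 + c ^ 2 ≠ 0 := by
    intro hw
    have ha : a = 0 := by nlinarith [sq_nonneg a, sq_nonneg b, sq_nonneg c]
    have hb : b = 0 := by nlinarith [sq_nonneg a, sq_nonneg b, sq_nonneg c]
    have hc : c = 0 := by nlinarith [sq_nonneg a, sq_nonneg b, sq_nonneg c]
    have hp : p = 0 := by nlinarith [sq_nonneg p, sq_nonneg q, sq_nonneg r]
    have hq : q = 0 := by nlinarith [sq_nonneg p, sq_nonneg q, sq_nonneg r]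
    have hr : r = 0 := by nlinarith [sq_nonneg p, sq_nonneg q, sq_nonneg r]
    refine hF0 ?_
    ext i j
    fin_cases i <;> fin_cases j <;>
      simp [h0, h1 0 1, h1 0 2, h1 0 3, h1 1 2, h1 1 3, h1 2 3, a, b, c, p, q, r] at * <;> assumption
  -- κ = (|E|², E × B), the energy density and the Poynting vector; it is null because |E × B| =
  -- |E|².
  refine ⟨(a ^ 2 + b ^ 2 + c ^ 2)⁻¹, ![a ^ 2 + b ^ 2 + c ^ 2, b * r + c * q, c * p - a * r,
    -(a * q) - b * p], inv_ne_zero hw, fun h => hw (congrFun h 0), ?_, ?_⟩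
  · simp [dotProduct, mulVec, LorentzMetric.eta, Fin.sum_univ_four, Matrix.diagonal_apply]
    grind
  · ext i j
    rw [Matrix.smul_apply, smul_eq_mul, eq_inv_mul_iff_mul_eq₀ hw, vecMulVec_apply, hT]
    fin_cases i <;> fin_cases j <;>
      simp [h0, h1 0 1, h1 0 2, h1 0 3, h1 1 2, h1 1 3, h1 2 3] <;> grind

end Coord

namespace LorentzMetric

variable {M : Type*} [TopologicalSpace M] [ChartedSpace R4 M] [IsManifold 𝓘(ℝ, R4) ∞ M]
  {g : LorentzMetric M} {e : OpenPartialHomeomorph M R4} {x : M} {Lam : ℝ}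

/-! ### Einstein's equations -/

theorem lower_apply (g : LorentzMetric M) (he : IsChart e) (hx : x ∈ e.source) (v : Tan x)
    (i : Fin 4) : (g.comp e (e x) *ᵥ vecComp e x v) i =
      g.form x v ((compEquiv he hx).symm (Pi.single i 1)) := by
  rw [g.symm, g.form_eq_dot he hx, ← compEquiv_apply he hx (LinearEquiv.symm _ _),
    LinearEquiv.apply_symm_apply, single_one_dotProduct]

theorem formComp_radiationStress (g : LorentzMetric M) (he : IsChart e) (hx : x ∈ e.source)
    (H : M → ℝ) (k : ∀ x : M, Tan x) (a b : Fin 4) :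
    formComp e (g.radiationStress H k) (e x) a b =
      H x * ((g.comp e (e x) *ᵥ vecComp e x (k x)) a
        * (g.comp e (e x) *ᵥ vecComp e x (k x)) b) := by
  rw [formComp_eq he hx, g.lower_apply he hx, g.lower_apply he hx]
  simp [radiationStress]

theorem IsPureRadiation.isNullRicci (h : g.IsPureRadiation Lam) (x : M) :
    ∃ φ v, g.IsNullRicci x Lam φ v := by
  obtain ⟨H, k, hk, hE⟩ := h
  obtain ⟨hH, hk0, hkk⟩ := hk x
  refine ⟨8 * Real.pi * H x, k x, fun e he hx => ?_⟩
  refine (g.isMetricOn he).isNullRicciAt_of_einstein (e.map_source hx)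
    (vecComp_ne_zero he hx hk0) (by positivity) ?_ fun a b => ?_
  · rw [← g.form_eq_dot he hx, hkk]
  · have := hE e he (e x) (e.map_source hx) a b
    rw [this, g.formComp_radiationStress he hx]
    ring

theorem isPureRadiation_of_isNullRicci (h : ∀ x, ∃ φ v, g.IsNullRicci x Lam φ v) :
    g.IsPureRadiation Lam := by
  choose φ k hr using h
  refine ⟨fun x => φ x / (8 * Real.pi), k, fun x => ⟨div_ne_zero (hr x).coeff_ne (by positivity),
    (hr x).vec_ne, (hr x).null⟩, fun e he y hy => ?_⟩
  obtain ⟨x, hx, rfl⟩ : ∃ x ∈ e.source, e x = y := ⟨e.symm y, e.map_target hy, e.right_inv hy⟩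
  intro a b
  rw [g.formComp_radiationStress he hx,
    (g.isMetricOn he).einstein_of_isNullRicciAt (e.map_source hx) (hr x e he hx)]
  field_simp

theorem transpose_mul_mul_cancel {P A B : Matrix (Fin 4) (Fin 4) ℝ} (hP : IsUnit P.det)
    (h : Pᵀ * A * P = Pᵀ * B * P) : A = B := by
  have hPt : IsUnit Pᵀ.det := by rwa [Matrix.det_transpose]
  have h1 : ∀ A, Pᵀ⁻¹ * (Pᵀ * A * P) * P⁻¹ = A := by
    intro A
    rw [Matrix.mul_assoc, Matrix.mul_assoc, Matrix.mul_assoc, Matrix.mul_nonsing_inv _ hP,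
      Matrix.mul_one, Matrix.nonsing_inv_mul_cancel_left _ _ hPt]
  rw [← h1 A, h, h1]

theorem IsNullElectromagnetic.isNullRicci (h : g.IsNullElectromagnetic Lam) (x : M) :
    ∃ φ v, g.IsNullRicci x Lam φ v := by
  obtain ⟨F, hF, hE⟩ := h
  obtain ⟨b, hb⟩ := g.exists_basisMat x
  set Fb : Matrix (Fin 4) (Fin 4) ℝ := Matrix.of fun i j => F x (b i) (b j) with hFb
  have hFe : ∀ e : OpenPartialHomeomorph M R4, IsChart e → x ∈ e.source →
      (basisMat e b)ᵀ * formComp e F (e x) * basisMat e b = Fb :=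
    fun e he hx => basisMat_transpose_mul he hx F b
  have hdet : ∀ e : OpenPartialHomeomorph M R4, IsChart e → x ∈ e.source →
      IsUnit (basisMat e b).det := by
    intro e he hx
    rw [isUnit_iff_ne_zero]
    intro h0
    have h1 := congrArg Matrix.det (hb e he hx)
    rw [Matrix.det_mul, h0, mul_zero] at h1
    have h2 := congrArg Matrix.det eta_mul_eta
    rw [Matrix.det_mul, ← h1] at h2
    simp at h2
  have hinv : ∀ e : OpenPartialHomeomorph M R4, IsChart e → x ∈ e.source →
      (g.comp e (e x))⁻¹ = basisMat e b * eta * (basisMat e b)ᵀ := by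
    intro e he hx
    refine Matrix.inv_eq_right_inv ?_
    have h1 : eta * ((basisMat e b)ᵀ * g.comp e (e x) * basisMat e b) = 1 := by
      rw [hb e he hx, eta_mul_eta]
    have h2 : (eta * (basisMat e b)ᵀ * g.comp e (e x)) * basisMat e b = 1 := by
      rw [← h1]; noncomm_ring
    have h3 := mul_eq_one_comm.1 h2
    have h4 : (basisMat e b * eta * (basisMat e b)ᵀ) * g.comp e (e x) = 1 := by
      rw [← h3]; noncomm_ring
    exact mul_eq_one_comm.1 h4
  have hT : ∀ e : OpenPartialHomeomorph M R4, IsChart e → x ∈ e.source →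
      (basisMat e b)ᵀ * (formComp e F (e x) * (g.comp e (e x))⁻¹ * (formComp e F (e x))ᵀ)
        * basisMat e b = Fb * eta * Fbᵀ := by
    intro e he hx
    rw [hinv e he hx, ← hFe e he hx]
    simp only [Matrix.transpose_mul, Matrix.transpose_transpose, Matrix.mul_assoc]
  have hanti : ∀ e : OpenPartialHomeomorph M R4, (formComp e F (e x))ᵀ = -formComp e F (e x) := by
    intro e
    ext i j
    exact hF _ _ _
  have hFanti : Fbᵀ = -Fb := by
    ext i j
    exact hF _ _ _
  have hx0 := mem_chart_source R4 x
  have he0 := isChart_chartAt x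
  obtain ⟨hnull0, -⟩ := hE _ he0 _ ((chartAt R4 x).map_source hx0)
  have hF0 : Fb ≠ 0 := by
    intro h0
    refine hnull0.1 (transpose_mul_mul_cancel (hdet _ he0 hx0) ?_)
    rw [hFe _ he0 hx0, h0, Matrix.mul_zero, Matrix.zero_mul]
  have hpf : Fb 0 1 * Fb 2 3 - Fb 0 2 * Fb 1 3 + Fb 0 3 * Fb 1 2 = 0 := by
    have h1 := Coord.det_of_antisymm hFanti
    rw [← hFe _ he0 hx0, Matrix.det_mul, Matrix.det_mul, Coord.det_of_antisymm (hanti _),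
      hnull0.2.2, hFe _ he0 hx0] at h1
    exact pow_eq_zero_iff two_ne_zero |>.1 (by linarith)
  have htr : (eta * (Fb * eta * Fbᵀ)ᵀ).trace = 0 := by
    have h1 := hnull0.2.1
    rw [Coord.sum_inv_mul_eq_trace, hinv _ he0 hx0] at h1
    rw [← h1, ← hFe _ he0 hx0]
    simp only [Matrix.transpose_mul, Matrix.transpose_transpose, Matrix.mul_assoc]
    rw [Matrix.trace_mul_comm (basisMat (chartAt R4 x) b)]
    simp only [Matrix.mul_assoc]
  obtain ⟨φ, κ, hφ, hκ, hκn, hκT⟩ := Coord.exists_null_stress hFanti hF0 hpf htr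
  -- κ is a covector in the orthonormal frame; η raises its index.
  refine ⟨8 * Real.pi * φ, ∑ j, (eta *ᵥ κ) j • b j, fun e he hx => ?_⟩
  obtain ⟨hnull, hEin⟩ := hE e he _ (e.map_source hx)
  have hu := hdet e he hx
  have hv : basisMat e b *ᵥ (eta *ᵥ κ) = vecComp e x (∑ j, (eta *ᵥ κ) j • b j) :=
    basisMat_mulVec he hx b _
  rw [← hv]
  have hlow : (basisMat e b)ᵀ *ᵥ (g.comp e (e x) *ᵥ (basisMat e b *ᵥ (eta *ᵥ κ))) = κ := by
    rw [mulVec_mulVec, mulVec_mulVec, mulVec_mulVec, hb e he hx, eta_mul_eta, one_mulVec]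
  have hstress : (Matrix.of fun a c => Coord.emStress (g.comp e (e x)) (formComp e F (e x)) a c) =
      φ • vecMulVec (g.comp e (e x) *ᵥ (basisMat e b *ᵥ (eta *ᵥ κ)))
        (g.comp e (e x) *ᵥ (basisMat e b *ᵥ (eta *ᵥ κ))) := by
    rw [Coord.emStress_eq hnull]
    refine transpose_mul_mul_cancel hu ?_
    rw [hT e he hx, hκT, Matrix.mul_smul, Matrix.smul_mul, Matrix.mul_vecMulVec,
      Matrix.vecMulVec_mul, hlow, ← Matrix.mulVec_transpose, hlow]
  refine (g.isMetricOn he).isNullRicciAt_of_einstein (e.map_source hx)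
    ?_ (by positivity) ?_ fun a c => ?_
  · intro h0
    apply hκ
    rw [← hlow, h0]
    simp
  · rw [dotProduct_comm, Matrix.dotProduct_mulVec, ← Matrix.mulVec_transpose, hlow, hκn]
  · have h2 := hEin a c
    have h3 := congrFun (congrFun hstress a) c
    rw [h2]
    simp only [Matrix.of_apply, Matrix.smul_apply, vecMulVec_apply, smul_eq_mul] at h3
    rw [h3]
    ring

/-- From the Segré type, the pure radiation alternative can always be chosen, point by point. -/
theorem segre_iff (g : LorentzMetric M) (Lam : ℝ) :
    (g.IsPureRadiation Lam ∨ g.IsNullElectromagnetic Lam) ↔ ∀ x, g.IsSegre211 x Lam := by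
  simp only [isSegre211_iff]
  exact ⟨fun h => h.elim IsPureRadiation.isNullRicci IsNullElectromagnetic.isNullRicci,
    fun h => Or.inl (isPureRadiation_of_isNullRicci h)⟩

end LorentzMetric

/-! ### Smooth vector fields -/

section VectorFields

variable {M : Type*} [TopologicalSpace M] [ChartedSpace R4 M] [IsManifold 𝓘(ℝ, R4) ∞ M]
  {e e' : OpenPartialHomeomorph M R4} {x : M}

theorem fieldComp_apply (hx : x ∈ e.source) (k : ∀ x : M, Tan x) :
    fieldComp e k (e x) = vecComp e x (k x) := by
  rw [fieldComp, e.left_inv hx]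

theorem contDiffOn_chart_change (he : IsChart e) (he' : IsChart e') :
    ContDiffOn ℝ ∞ (e' ∘ e.symm) (e.target ∩ e.symm ⁻¹' e'.source) := by
  rw [← contMDiffOn_iff_contDiffOn]
  exact (contMDiffOn_of_mem_maximalAtlas he').comp
    ((contMDiffOn_symm_of_mem_maximalAtlas he).mono Set.inter_subset_left) fun y hy => hy.2

theorem vecComp_chart_change (he : IsChart e) (he' : IsChart e') (hx : x ∈ e.source)
    (hx' : x ∈ e'.source) (v : Tan x) :
    WithLp.toLp 2 (vecComp e' x v) =
      fderiv ℝ (e' ∘ e.symm) (e x) (WithLp.toLp 2 (vecComp e x v)) := by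
  have hW : IsOpen (e.target ∩ e.symm ⁻¹' e'.source) :=
    e.symm.isOpen_inter_preimage e'.open_source
  have hmem : e x ∈ e.target ∩ e.symm ⁻¹' e'.source :=
    ⟨e.map_source hx, by simpa [e.left_inv hx] using hx'⟩
  have hd : DifferentiableAt ℝ (e' ∘ e.symm) (e x) :=
    ((contDiffOn_chart_change he he').contDiffAt (hW.mem_nhds hmem)).differentiableAt (by simp)
  have h1 : e' =ᶠ[𝓝 x] (e' ∘ e.symm) ∘ e := by
    filter_upwards [e.open_source.mem_nhds hx] with z hz
    simp [e.left_inv hz]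
  have h2 : mfderiv 𝓘(ℝ, R4) 𝓘(ℝ, R4) e' x =
      (mfderiv 𝓘(ℝ, R4) 𝓘(ℝ, R4) (e' ∘ e.symm) (e x)).comp
        (mfderiv 𝓘(ℝ, R4) 𝓘(ℝ, R4) e x) := by
    rw [h1.mfderiv_eq]
    exact mfderiv_comp x hd.mdifferentiableAt (he.mdifferentiable.mdifferentiableAt hx)
  have h3 := DFunLike.congr_fun h2 v
  rw [mfderiv_eq_fderiv] at h3
  exact h3

/-- Components transform with the Jacobian of the transition map, so one chart covering U suffices.
-/
theorem isSmoothVectorField_of_chart (he : IsChart e) {U : Set M}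
    (hUe : U ⊆ e.source) {k : ∀ x : M, Tan x}
    (hk : ∀ i, ContDiffOn ℝ ∞ (fun y => fieldComp e k y i) (e.target ∩ e.symm ⁻¹' U)) :
    IsSmoothVectorField U k := by
  intro e' he' i
  have hW : IsOpen (e.target ∩ e.symm ⁻¹' e'.source) :=
    e.symm.isOpen_inter_preimage e'.open_source
  have h1 : ContDiffOn ℝ ∞ (fun y => (WithLp.toLp 2 (fieldComp e k y) : R4))
      (e.target ∩ e.symm ⁻¹' U) := contDiffOn_euclidean.2 hk
  have hτ : ContDiffOn ℝ ∞ (e ∘ e'.symm) (e'.target ∩ e'.symm ⁻¹' U) :=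
    (contDiffOn_chart_change he' he).mono fun y hy => ⟨hy.1, hUe hy.2⟩
  have h2 : ContDiffOn ℝ ∞ (fun y => fderiv ℝ (e' ∘ e.symm) ((e ∘ e'.symm) y)
      (WithLp.toLp 2 (fieldComp e k ((e ∘ e'.symm) y)))) (e'.target ∩ e'.symm ⁻¹' U) := by
    refine ContDiffOn.clm_apply ?_ ?_
    · refine ((contDiffOn_chart_change he he').fderiv_of_isOpen hW (by simp)).comp hτ ?_
      intro y hy
      refine ⟨e.map_source (hUe hy.2), ?_⟩
      simp only [Set.mem_preimage, Function.comp_apply]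
      rw [e.left_inv (hUe hy.2)]
      exact e'.map_target hy.1
    · refine h1.comp hτ fun y hy => ⟨e.map_source (hUe hy.2), ?_⟩
      simp only [Set.mem_preimage, Function.comp_apply]
      rw [e.left_inv (hUe hy.2)]
      exact hy.2
  refine (contDiffOn_euclidean.1 h2 i).congr fun y hy => ?_
  simp only [Function.comp_apply]
  rw [fieldComp_apply (hUe hy.2),
    ← vecComp_chart_change he he' (hUe hy.2) (e'.map_target hy.1)]
  rfl

end VectorFields

/-! ### Constancy of the eigenvalue and the Kundt congruence -/

namespace LorentzMetric

variable {M : Type*} [TopologicalSpace M] [ChartedSpace R4 M] [IsManifold 𝓘(ℝ, R4) ∞ M]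
  {g : LorentzMetric M} {e : OpenPartialHomeomorph M R4} {x : M}

theorem IsYangPureSpace.isCodazzi (hY : g.IsYangPureSpace) (he : IsChart e) :
    Coord.IsCodazzi e.target (g.comp e) :=
  hY e he

theorem IsNullRicci.scalar_eq {lam φ : ℝ} {v : Tan x} (hr : g.IsNullRicci x lam φ v)
    (he : IsChart e) (hx : x ∈ e.source) : Coord.scalar (g.comp e) (e x) = 4 * lam :=
  (g.isMetricOn he).scalar_eq (e.map_source hx) (hr e he hx)

theorem IsYangPureSpace.fderiv_scalar (hY : g.IsYangPureSpace) (he : IsChart e) {y : R4}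
    (hy : y ∈ e.target) : fderiv ℝ (Coord.scalar (g.comp e)) y = 0 := by
  refine ContinuousLinearMap.coe_injective
    ((EuclideanSpace.basisFun (Fin 4) ℝ).toBasis.ext fun i => ?_)
  simpa [Coord.pd] using (g.isMetricOn he).pd_scalar_eq_zero (hY.isCodazzi he) hy i

/-- The eigenvalue of the Ricci tensor is locally constant. -/
theorem IsYangPureSpace.isLocallyConstant (hY : g.IsYangPureSpace) {lam : M → ℝ}
    (hs : ∀ x, g.IsSegre211 x (lam x)) : IsLocallyConstant lam := by
  rw [IsLocallyConstant.iff_eventually_eq]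
  intro x
  have hx := mem_chart_source R4 x
  have he := isChart_chartAt x
  set e := chartAt R4 x
  -- On a coordinate ball, which is convex, dR = 0 makes R = 4λ constant.
  obtain ⟨r, hr, hball⟩ := Metric.isOpen_iff.1 e.open_target (e x) (e.map_source hx)
  have hlam : ∀ z ∈ e.source, Coord.scalar (g.comp e) (e z) = 4 * lam z := by
    intro z hz
    obtain ⟨φ, v, h⟩ := (hs z).exists_isNullRicci
    exact h.scalar_eq he hz
  filter_upwards [e.open_source.mem_nhds hx,
    (e.continuousAt hx).preimage_mem_nhds (Metric.ball_mem_nhds _ hr)] with z hz hzb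
  have hconst := (convex_ball (e x) r).is_const_of_fderivWithin_eq_zero (𝕜 := ℝ)
    (f := Coord.scalar (g.comp e))
    (((g.isMetricOn he).smooth_scalar.differentiableOn (by simp)).mono hball)
    (fun y hy => by rw [fderivWithin_of_isOpen Metric.isOpen_ball hy,
      hY.fderiv_scalar he (hball hy)]) hzb (Metric.mem_ball_self hr)
  rw [hlam z hz, hlam x hx] at hconst
  linarith

/-- The line field spanned by `v` has smooth local sections. -/
theorem exists_smooth_section (g : LorentzMetric M) {v : ∀ x : M, Tan x}
    (hv : ∀ x, ∃ lam φ, g.IsNullRicci x lam φ (v x)) (x : M) :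
    ∃ U : Set M, IsOpen U ∧ x ∈ U ∧ ∃ k : ∀ x : M, Tan x, IsSmoothVectorField U k ∧
      ∀ z ∈ U, k z ≠ 0 ∧ Submodule.span ℝ {v z} = Submodule.span ℝ {k z} := by
  classical
  have hx := mem_chart_source R4 x
  have he := isChart_chartAt x
  set e := chartAt R4 x
  have H := g.isMetricOn he
  -- Column i of the trace-free Ricci tensor equals φ v_i v. It is smooth although v is an arbitrary
  -- choice, and it spans the line wherever it does not vanish.
  let col : Fin 4 → R4 → Fin 4 → ℝ := fun i y c => Coord.ricciEnd (g.comp e) y c i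
    - Coord.scalar (g.comp e) y * ((1 : Matrix (Fin 4) (Fin 4) ℝ) c i / 4)
  have hcol : ∀ z (hz : z ∈ e.source), ∃ φ, φ ≠ 0 ∧ ∀ i, col i (e z) =
      (φ * (g.comp e (e z) *ᵥ vecComp e z (v z)) i) • vecComp e z (v z) := by
    intro z hz
    obtain ⟨lam, φ, h⟩ := hv z
    refine ⟨φ, h.coeff_ne, fun i => ?_⟩
    funext c
    simp only [col]
    rw [h.scalar_eq he hz, H.ricciEnd_eq (e.map_source hz) (h e he hz)]
    simp only [Matrix.add_apply, Matrix.smul_apply, vecMulVec_apply, smul_eq_mul, Pi.smul_apply]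
    ring
  have hsm : ∀ i c, ContDiffOn ℝ ∞ (fun y => col i y c) e.target := fun i c =>
    (H.smooth_ricciEnd c i).sub (H.smooth_scalar.mul contDiffOn_const)
  obtain ⟨lam, φ₀, hx0⟩ := hv x
  obtain ⟨i, hi⟩ := Function.ne_iff.1
    (H.lower_ne_zero (e.map_source hx) (vecComp_ne_zero he hx hx0.vec_ne))
  have hO : IsOpen (e.target ∩ col i ⁻¹' {0}ᶜ) :=
    (continuousOn_pi.2 fun c => (hsm i c).continuousOn).isOpen_inter_preimage e.open_target
      isOpen_compl_singleton
  let k : ∀ z : M, Tan z := fun z =>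
    if hz : z ∈ e.source then (compEquiv he hz).symm (col i (e z)) else 0
  have hk : ∀ z, ∀ hz : z ∈ e.source, k z = (compEquiv he hz).symm (col i (e z)) :=
    fun z hz => dif_pos hz
  refine ⟨e.source ∩ e ⁻¹' (e.target ∩ col i ⁻¹' {0}ᶜ), e.isOpen_inter_preimage hO,
    ⟨hx, e.map_source hx, ?_⟩, k, ?_, ?_⟩
  · obtain ⟨φ, hφ, h⟩ := hcol x hx
    simp only [Set.mem_preimage, Set.mem_compl_iff, Set.mem_singleton_iff, h]
    exact smul_ne_zero (mul_ne_zero hφ hi) (vecComp_ne_zero he hx hx0.vec_ne)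
  · refine isSmoothVectorField_of_chart he Set.inter_subset_left
      fun c => ((hsm i c).mono Set.inter_subset_left).congr fun y hy => ?_
    obtain ⟨z, hz, rfl⟩ : ∃ z ∈ e.source, e z = y := ⟨e.symm y, e.map_target hy.1, e.right_inv hy.1⟩
    rw [fieldComp_apply hz, hk z hz, ← compEquiv_apply he hz, LinearEquiv.apply_symm_apply]
  · rintro z ⟨hz, -, hz0⟩
    obtain ⟨φ, hφ, h⟩ := hcol z hz
    have hk0 : k z ≠ 0 := by
      rw [hk z hz]
      simpa using hz0
    have hkv : k z = (φ * (g.comp e (e z) *ᵥ vecComp e z (v z)) i) • v z := by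
      rw [hk z hz, h, map_smul, ← compEquiv_apply he hz, LinearEquiv.symm_apply_apply]
    refine ⟨hk0, ?_⟩
    rw [hkv]
    refine (Submodule.span_singleton_smul_eq (IsUnit.mk0 _ fun h0 => hk0 ?_) _).symm
    rw [hkv, h0, zero_smul]

theorem exists_isNullRicci_of_mem {v u : Tan x} (hv : ∃ lam φ, g.IsNullRicci x lam φ v)
    (hu : u ∈ Submodule.span ℝ {v}) (hu0 : u ≠ 0) : ∃ lam φ, g.IsNullRicci x lam φ u := by
  obtain ⟨c, rfl⟩ := Submodule.mem_span_singleton.1 hu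
  obtain ⟨lam, φ, h⟩ := hv
  exact ⟨lam, _, h.smul fun hc => hu0 (by rw [hc, zero_smul])⟩

/-- A non-zero section of the line field is again a vector of the normal form, with rescaled φ, so
the results on ∇K apply to it in every chart. -/
theorem IsYangPureSpace.isKundtCongruence (hY : g.IsYangPureSpace) {v : ∀ x : M, Tan x}
    (hv : ∀ x, ∃ lam φ, g.IsNullRicci x lam φ (v x)) :
    g.IsKundtCongruence fun x => Submodule.span ℝ {v x} := by
  refine ⟨g.exists_smooth_section hv, fun U k hU hk hkL z hz => ?_⟩
  have hr : ∀ z ∈ U, ∃ lam φ, g.IsNullRicci z lam φ (k z) := fun z hz =>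
    exists_isNullRicci_of_mem (hv z) (hkL z hz).2 (hkL z hz).1
  have hrc : ∀ e : OpenPartialHomeomorph M R4, IsChart e → ∀ y ∈ e.target ∩ e.symm ⁻¹' U,
      ∃ lam φ, Coord.IsNullRicciAt (g.comp e) y lam φ (fieldComp e k y) := by
    rintro e he y ⟨hy, hyU⟩
    obtain ⟨lam, φ, h⟩ := hr _ hyU
    have := h e he (e.map_target hy)
    rw [e.right_inv hy] at this
    exact ⟨lam, φ, this⟩
  have hV : ∀ e : OpenPartialHomeomorph M R4, IsOpen (e.target ∩ e.symm ⁻¹' U) := fun e =>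
    e.symm.isOpen_inter_preimage hU
  have hmem : ∀ e : OpenPartialHomeomorph M R4, z ∈ e.source →
      e z ∈ e.target ∩ e.symm ⁻¹' U := fun e hze =>
    ⟨e.map_source hze, by simpa [e.left_inv hze] using hz⟩
  obtain ⟨lam, φ, hz0⟩ := hr z hz
  refine ⟨hz0.null, fun e he hze => ?_, fun n s t ht e he hze => ?_⟩
  · rw [← fieldComp_apply hze]
    refine (g.isMetricOn he).exists_covVec_eq (hY.isCodazzi he) (hV e) Set.inter_subset_left
      (hk e he) (hrc e he) (hmem e hze) ?_
    rw [fieldComp_apply hze, ← g.form_eq_dot he hze, hz0.null]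
  · have hs : vecComp e z s ⬝ᵥ g.comp e (e z) *ᵥ fieldComp e k (e z) = 0 := by
      rw [fieldComp_apply hze, ← g.form_eq_dot he hze, g.symm, ht.ks]
    have ht : vecComp e z t ⬝ᵥ g.comp e (e z) *ᵥ fieldComp e k (e z) = 0 := by
      rw [fieldComp_apply hze, ← g.form_eq_dot he hze, g.symm, ht.kt]
    have key := fun X Z hX hZ => (g.isMetricOn he).sum_covLow (hY.isCodazzi he) (hV e)
      Set.inter_subset_left (hk e he) (hrc e he) (hmem e hze) (X := X) (Z := Z) hX hZ
    have hρ := Coord.npRho_eq_zero (key _ _ hs hs) (key _ _ ht hs) (key _ _ hs ht)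
      (key _ _ ht ht)
    refine ⟨by simp [Coord.expansion, hρ], by simp [Coord.twist, hρ],
      Coord.npSigma_eq_zero (key _ _ hs hs) (key _ _ ht hs) (key _ _ hs ht) (key _ _ ht ht)⟩

theorem IsYangPureSpace.isRepeatedPND (hY : g.IsYangPureSpace) {lam φ : ℝ} {v : Tan x}
    (hr : g.IsNullRicci x lam φ v) : g.IsRepeatedPND x v :=
  ⟨hr.vec_ne, hr.null, fun e he hx a d f =>
    (g.isMetricOn he).weyl_bel (hY.isCodazzi he) (e.map_source hx) (hr e he hx) a d f⟩

theorem IsYangPureSpace.psi2Real (hY : g.IsYangPureSpace) {lam φ : ℝ} {k n s t : Tan x}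
    (hr : g.IsNullRicci x lam φ k) (ht : g.IsNullTetrad x k n s t) : g.Psi2Real x k n s t := by
  intro e he hx
  refine Coord.conj_psi2 _ _ _ _ _ _ ((g.isMetricOn he).weyl_symm (hY.isCodazzi he)
    (e.map_source hx) (hr e he hx) ?_ ?_ ?_)
  · rw [← g.form_eq_dot he hx, ht.kn]
    norm_num
  · rw [← g.form_eq_dot he hx, ht.ks]
  · rw [← g.form_eq_dot he hx, ht.kt]

end LorentzMetric

end

theorem mainTheorem7 {M : Type*} [TopologicalSpace M] [ChartedSpace R4 M]
    [IsManifold 𝓘(ℝ, R4) ∞ M] (g : LorentzMetric M) (hYang : g.IsYangPureSpace) :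
    -- pure radiation or null electromagnetic field is equivalent to Segré type {(2,11)}
    ((∀ Lam : ℝ, (g.IsPureRadiation Lam ∨ g.IsNullElectromagnetic Lam) ↔
        ∀ x, g.IsSegre211 x Lam) ∧
      (PreconnectedSpace M → (∀ x, ∃ lam, g.IsSegre211 x lam) →
        ∃ Lam, ∀ x, g.IsSegre211 x Lam)) ∧
    -- Segré type {(2,11)} implies Kundt's class, with the congruence described
    ((∀ x, ∃ lam, g.IsSegre211 x lam) →
      g.InKundtClass ∧
      ∃ L : ∀ x : M, Submodule ℝ (Tan x), g.IsKundtCongruence L ∧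
        ∀ x : M,
          (∀ v : Tan x, v ≠ 0 → (v ∈ L x ↔ g.IsDoubleNullEigenvector x v)) ∧
          (∀ v ∈ L x, v ≠ 0 → g.IsRepeatedPND x v) ∧
          (∀ k n s t : Tan x, g.IsNullTetrad x k n s t → k ∈ L x → g.Psi2Real x k n s t)) := by
  refine ⟨⟨g.segre_iff, fun _ hs => ?_⟩, fun hs => ?_⟩
  · choose lam hlam using hs
    rcases isEmpty_or_nonempty M with hM | ⟨⟨x₀⟩⟩
    -- A preconnected space may be empty; any constant serves then.
    · exact ⟨0, fun x => (hM.false x).elim⟩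
    · refine ⟨lam x₀, fun x => ?_⟩
      rw [← (hYang.isLocallyConstant hlam).apply_eq_of_preconnectedSpace x x₀]
      exact hlam x
  · have hs' : ∀ x, ∃ v : Tan x, ∃ lam φ, g.IsNullRicci x lam φ v := fun x => by
      obtain ⟨lam, h⟩ := hs x
      obtain ⟨φ, v, h⟩ := h.exists_isNullRicci
      exact ⟨v, lam, φ, h⟩
    choose v hv using hs'
    have hL := hYang.isKundtCongruence hv
    refine ⟨⟨_, hL⟩, _, hL, fun x => ⟨fun u hu => ?_, fun u hu hu0 => ?_,
      fun k n s t ht hk => ?_⟩⟩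
    · obtain ⟨lam, φ, h⟩ := hv x
      exact (h.isDoubleNullEigenvector_iff hu).symm
    · obtain ⟨lam, φ, h⟩ := LorentzMetric.exists_isNullRicci_of_mem (hv x) hu hu0
      exact hYang.isRepeatedPND h
    · have hk0 : k ≠ 0 := by
        rintro rfl
        simpa using ht.kn
      obtain ⟨lam, φ, h⟩ := LorentzMetric.exists_isNullRicci_of_mem (hv x) hk hk0
      exact hYang.psi2Real h ht
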